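/- Let $A$ be a finite alphabet. For an NFA $\mathcal A$ over $A$ and $B\subseteq A$, write $p\xrightarrow{u}q$ for a path labelled by the word $u$, $p\xrightarrow{\subseteq B}q$ for a path all of whose labels are in $B$, and $p\xrightarrow{=B}q$ for a path whose set of labels is exactly $B$. The size of an NFA is its number of states plus its number of transitions. A factorization pair $(\vec u,\vec B)$ consists of words $u_0,\dots,u_p\in A^*$ and nonempty sets $B_1,\dots,B_p\subseteq A$, for some $p\ge 0$. A $(\vec u,\vec B)$-path in $\mathcal A$ is a path from an initial state to a final state of the form $$s_0\xrightarrow{u_0}t_0\xrightarrow{\subseteq B_1}c_1\xrightarrow{=B_1}c_1\xrightarrow{\subseteq B_1}s_1\xrightarrow{u_1}t_1\ \cdots\ t_{p-1}\xrightarrow{\subseteq B_p}c_p\xrightarrow{=B_p}c_p\xrightarrow{\subseteq B_p}s_p\xrightarrow{u_p}t_p .$$ A witness of non-separability by piecewise testable languages for two NFAs $(\mathcal A_1,\mathcal A_2)$ over $A$ is a factorization pair $(\vec u,\vec B)$ such that both $\mathcal A_1$ and $\mathcal A_2$ have a $(\vec u,\vec B)$-path. There is an algorithm which, given two NFAs $\mathcal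 A_1$ and $\mathcal A_2$ over a common finite alphabet $A$ (the alphabet being part of the input), determines whether there exists a witness of non-separability by piecewise testable languages for $(\mathcal A_1,\mathcal A_2)$, in time polynomial in the size of $\mathcal A_1$, the size of $\mathcal A_2$ and $|A|$. -/

import Mathlib

/-! ## Random-access machines -/

namespace RAM

/-- Instructions of a random-access machine (load/store form, in the style of Cook and Reckhow).
The machine has registers `R 0, R 1, …` and memory cells `M 0, M 1, …`, all holding natural
numbers.  Besides loads, stores and zero tests, the only arithmetic operations are addition and
truncated subtraction, so polynomial time under unit cost is polynomial time on Turing machines. -/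
inductive Instr where
  /-- `R i := c` -/
  | const (i c : ℕ)
  /-- `R i := R j + R k` -/
  | add (i j k : ℕ)
  /-- `R i := R j - R k` (truncated at `0`) -/
  | sub (i j k : ℕ)
  /-- `R i := M (R j)` -/
  | load (i j : ℕ)
  /-- `M (R i) := R j` -/
  | store (i j : ℕ)
  /-- if `R i = 0` then go to instruction number `l`, otherwise continue with the next one -/
  | jz (i l : ℕ)

/-- A program is a finite list of instructions, numbered from `0`. -/
abbrev Program := List Instr

/-- A configuration: program counter, contents of the registers, contents of the memory. -/
structure Config where
  pc : ℕ
  reg : ℕ → ℕ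
  mem : ℕ → ℕ

/-- The effect of a single instruction. -/
def Instr.exec (c : Config) : Instr → Config
  | .const i n => ⟨c.pc + 1, Function.update c.reg i n, c.mem⟩
  | .add i j k => ⟨c.pc + 1, Function.update c.reg i (c.reg j + c.reg k), c.mem⟩
  | .sub i j k => ⟨c.pc + 1, Function.update c.reg i (c.reg j - c.reg k), c.mem⟩
  | .load i j => ⟨c.pc + 1, Function.update c.reg i (c.mem (c.reg j)), c.mem⟩
  | .store i j => ⟨c.pc + 1, c.reg, Function.update c.mem (c.reg i) (c.reg j)⟩
  | .jz i l => ⟨if c.reg i = 0 then l else c.pc + 1, c.reg, c.mem⟩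

/-- One step: execute the instruction under the program counter.  A configuration whose program
counter points outside the program is halted and does not change any more. -/
def step (P : Program) (c : Config) : Config :=
  match P[c.pc]? with
  | some ins => ins.exec c
  | none => c

/-- The program counter points outside the program. -/
def Halted (P : Program) (c : Config) : Prop := P.length ≤ c.pc

/-- The initial configuration on input `w`: the input occupies the memory cells
`0, …, w.length - 1`; everything else is `0`. -/
def init (w : List ℕ) : Config := ⟨0, fun _ => 0, fun i => w.getD i 0⟩

/-- On input `w`, the program `P` halts after at most `T` steps (one per executed instruction),
and when it has halted, register `0` contains `r`. -/
def OutputsInTime (P : Program) (w : List ℕ) (r T : ℕ) : Prop :=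
  ∃ t ≤ T, Halted P ((step P)^[t] (init w)) ∧ ((step P)^[t] (init w)).reg 0 = r

end RAM

/-! ## Automata, paths and witnesses -/

namespace NFA

variable {α σ : Type*}

/-- The size of an automaton: its number of states plus its number of transitions. -/
noncomputable def size (A : NFA α σ) : ℕ :=
  Nat.card σ + Set.ncard {t : σ × α × σ | t.2.2 ∈ A.step t.1 t.2.1}

/-- There is a path from `p` to `q` labelled by the word `u`. -/
def HasPath (A : NFA α σ) (p q : σ) (u : List α) : Prop :=
  Nonempty (A.Path p q u)

/-- There is a path from `p` to `q` all of whose transitions are labelled over `B`. -/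
def HasPathSubset (A : NFA α σ) (p q : σ) (B : Set α) : Prop :=
  ∃ u : List α, A.HasPath p q u ∧ {a | a ∈ u} ⊆ B

/-- There is a path from `p` to `q` all of whose transitions are labelled over `B` and along
which every letter of `B` occurs. -/
def HasPathEq (A : NFA α σ) (p q : σ) (B : Set α) : Prop :=
  ∃ u : List α, A.HasPath p q u ∧ {a | a ∈ u} = B

end NFA

/-- A factorization pair: words `u 0, …, u p` and nonempty subalphabets, where `B i` (for
`i = 0, …, p - 1`) is the subalphabet between `u i` and `u (i + 1)`. -/
structure FactorizationPair (α : Type*) where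
  p : ℕ
  u : Fin (p + 1) → List α
  B : Fin p → Set α
  nonempty : ∀ i, (B i).Nonempty

/-- `A` has a `(u, B)`-path: a path from an initial to a final state which reads `u i` from `s i`
to `t i`, and goes from `t i` to `s (i + 1)` through a state `c i`, using only letters of `B i`,
such that there is a loop around `c i` whose set of labels is exactly `B i`. -/
def NFA.HasUBPath {α σ : Type*} (A : NFA α σ) (π : FactorizationPair α) : Prop :=
  ∃ (s t : Fin (π.p + 1) → σ) (c : Fin π.p → σ),
    s 0 ∈ A.start ∧ t (Fin.last π.p) ∈ A.accept ∧
    (∀ i, A.HasPath (s i) (t i) (π.u i)) ∧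
    ∀ i : Fin π.p,
      A.HasPathSubset (t i.castSucc) (c i) (π.B i) ∧
      A.HasPathEq (c i) (c i) (π.B i) ∧
      A.HasPathSubset (c i) (s i.succ) (π.B i)

/-- A witness of non-separability by piecewise testable languages for `(A₁, A₂)`. -/
def IsNonPTSepWitness {α σ₁ σ₂ : Type*} (A₁ : NFA α σ₁) (A₂ : NFA α σ₂)
    (π : FactorizationPair α) : Prop :=
  A₁.HasUBPath π ∧ A₂.HasUBPath π

/-! ## Automata as inputs of a machine -/

/-- `1` for a true proposition, `0` for a false one. -/
noncomputable def bit (P : Prop) : ℕ :=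
  open Classical in if P then 1 else 0

/-- An automaton with alphabet `{0, …, m - 1}` and states `{0, …, n - 1}` as a list of bits: the
table of the initial states, the table of the final states, and the table of the transitions, in
which the entry of `(p, a, q)` has index `(p * m + a) * n + q`. -/
noncomputable def NFA.encode {m n : ℕ} (A : NFA (Fin m) (Fin n)) : List ℕ :=
  (List.finRange n).map (fun q => bit (q ∈ A.start)) ++
  (List.finRange n).map (fun q => bit (q ∈ A.accept)) ++
  (List.finRange n).flatMap (fun p => (List.finRange m).flatMap (fun a =>
    (List.finRange n).map (fun q => bit (q ∈ A.step p a))))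

/-- Two automata over the same alphabet as a machine input: the number of letters, the two numbers
of states, and the tables of the two automata. -/
noncomputable def encodePair {m n₁ n₂ : ℕ} (A₁ : NFA (Fin m) (Fin n₁))
    (A₂ : NFA (Fin m) (Fin n₂)) : List ℕ :=
  m :: n₁ :: n₂ :: (A₁.encode ++ A₂.encode)

/-! There are exponentially many candidate alphabets `B i`, but only one per pair of states matters.
If `B` and `B'` both label loops around `c₁` and around `c₂` exactly, then so does their union, by
concatenating loops. Hence each pair `(c₁, c₂)` has a greatest common loop alphabet, and replacing
any `B i` by it keeps all the paths required. It is found by descent from the full alphabet: in each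
round, drop the letters that are not on a loop over the current alphabet in both automata. A set
that labels both loops exactly survives every round (`subset_letterLevel`). After as many rounds as
there are letters the process is stationary, and the remaining letters do label such loops
(`hasPathEq_letterLevel`).

A witness is then a path from an initial to a final pair in a graph on pairs of states, whose edges
read a common letter or pass through some `(c₁, c₂)` over its greatest alphabet
(`exists_isNonPTSepWitness_iff`). The whole computation is thus a bounded number of reachability
rounds.

To run it on the machine, two small languages are compiled to RAM code: expressions with bounded
sums and programs with bounded loops. Sums and loops are bounded by variables, never by memory
contents, so a polynomial in the largest variable bounds the running time (`Expr.runs_comp`,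
`Prog.runs_comp`). The relations are kept in tables of side `side m n₁ n₂`, filled by
`Prog.eval_assign`; a nonzero entry means true, sums act as disjunctions and bounded sums as
existential quantifiers. `Prog.eval_result` joins the two halves. -/

namespace RAM

/-! ### Structured commands -/

/-- Structured commands, to be compiled to RAM programs. -/
inductive Cmd where
  /-- a single instruction -/
  | ins (i : Instr)
  /-- sequential composition -/
  | seq (a b : Cmd)
  /-- repeat the body while `R r ≠ 0` -/
  | loop (r : ℕ) (body : Cmd)

namespace Cmd

/-- Number of instructions of the compiled command. -/
def size : Cmd → ℕ
  | ins _ => 1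
  | seq a b => a.size + b.size
  | loop _ b => b.size + 2

/-- The compiled command, to be placed at address `off`.  Register `0` serves as a zero for
unconditional jumps. -/
def code : Cmd → ℕ → List Instr
  | ins i, _ => [i]
  | seq a b, off => a.code off ++ b.code (off + a.size)
  | loop r b, off => Instr.jz r (off + b.size + 2) :: (b.code (off + 1) ++ [Instr.jz 0 off])

theorem length_code (c : Cmd) (off : ℕ) : (c.code off).length = c.size := by
  induction c generalizing off <;> simp_all [code, size]

/-- Big-step semantics with running time. -/
inductive Runs : Cmd → (ℕ → ℕ) → (ℕ → ℕ) → (ℕ → ℕ) → (ℕ → ℕ) → ℕ → Prop where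
  | ins {i : Instr} {reg mem reg' mem'}
      (h : ∀ pc, i.exec ⟨pc, reg, mem⟩ = ⟨pc + 1, reg', mem'⟩) : Runs (ins i) reg mem reg' mem' 1
  | seq {a b reg mem reg₁ mem₁ reg₂ mem₂ t₁ t₂} (ha : Runs a reg mem reg₁ mem₁ t₁)
      (hb : Runs b reg₁ mem₁ reg₂ mem₂ t₂) : Runs (seq a b) reg mem reg₂ mem₂ (t₁ + t₂)
  | loop_done {r b reg mem} (h : reg r = 0) : Runs (loop r b) reg mem reg mem 1
  -- The jump back tests register `0`, so it is unconditional only if the body leaves a zero there;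
  -- the `2` counts the test at the head and this jump.
  | loop_step {r b reg mem reg₁ mem₁ reg₂ mem₂ t₁ t₂} (h : reg r ≠ 0)
      (hb : Runs b reg mem reg₁ mem₁ t₁) (h0 : reg₁ 0 = 0)
      (hl : Runs (loop r b) reg₁ mem₁ reg₂ mem₂ t₂) :
      Runs (loop r b) reg mem reg₂ mem₂ (t₁ + t₂ + 2)

theorem step_eq_of_getElem? {P : Program} {c : Config} {i : Instr} (h : P[c.pc]? = some i) :
    step P c = i.exec c := by
  simp [step, h]

/-- Jump targets are absolute, so the induction needs arbitrary code `X` before and `Y` after the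
command: each subcommand is then executed at its true address inside one fixed program. -/
theorem Runs.iterate_step {c : Cmd} {reg mem reg' mem' t}
    (h : Runs c reg mem reg' mem' t) (X Y : List Instr) :
    (step (X ++ c.code X.length ++ Y))^[t] ⟨X.length, reg, mem⟩ =
      ⟨X.length + c.size, reg', mem'⟩ := by
  induction h generalizing X Y with
  | ins h =>
    rw [Function.iterate_one, step_eq_of_getElem? (i := _), h]
    · rfl
    · simp [code]
  | @seq a b _ _ _ _ _ _ t₁ t₂ ha hb iha ihb =>
    rw [add_comm, Function.iterate_add_apply]
    have e1 := iha X (b.code (X.length + a.size) ++ Y)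
    have e2 := ihb (X ++ a.code X.length) Y
    simp only [List.length_append, length_code] at e2
    simp only [code, size, ← List.append_assoc] at *
    rw [e1, e2, add_assoc]
  | @loop_done r b reg mem h =>
    rw [Function.iterate_one, step_eq_of_getElem? (i := Instr.jz r (X.length + b.size + 2))]
    · simp [Instr.exec, h, size, add_assoc]
    · simp [code]
  | @loop_step r b reg mem reg₁ mem₁ reg₂ mem₂ t₁ t₂ h hb h0 hl ihb ihl =>
    have e1 := ihb (X ++ [Instr.jz r (X.length + b.size + 2)]) ([Instr.jz 0 X.length] ++ Y)
    have e2 := ihl X Y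
    have hP : X ++ [Instr.jz r (X.length + b.size + 2)] ++
        b.code (X ++ [Instr.jz r (X.length + b.size + 2)]).length ++
          ([Instr.jz 0 X.length] ++ Y) = X ++ (loop r b).code X.length ++ Y := by
      simp [code]
    rw [hP] at e1
    -- From the right: the test at the head, the body, the jump back, the remaining rounds.
    rw [show t₁ + t₂ + 2 = t₂ + (1 + (t₁ + 1)) by ring, Function.iterate_add_apply,
      Function.iterate_add_apply, Function.iterate_add_apply, Function.iterate_one,
      step_eq_of_getElem? (c := ⟨X.length, reg, mem⟩) (i := Instr.jz r (X.length + b.size + 2))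
        (by simp [code])]
    simp only [Instr.exec, h, if_false]
    simp only [List.length_append, List.length_singleton] at e1
    rw [e1, step_eq_of_getElem? (i := Instr.jz 0 X.length), ← e2]
    · simp [Instr.exec, h0]
    · rw [← hP, List.getElem?_append_right (by simp [length_code]; omega)]
      simp [length_code, show X.length + 1 + b.size - (X.length + (b.size + 1)) = 0 by omega]

theorem Runs.outputsInTime {c : Cmd} {w : List ℕ} {reg' mem' t T}
    (h : Runs c (fun _ => 0) (fun i => w.getD i 0) reg' mem' t) (hT : t ≤ T) :
    OutputsInTime (c.code 0) w (reg' 0) T := by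
  have := h.iterate_step [] []
  simp only [List.length_nil, List.nil_append, List.append_nil, zero_add] at this
  refine ⟨t, hT, ?_, ?_⟩
  · simp only [init, this, Halted, length_code]; exact le_rfl
  · simp only [init, this]

theorem Runs.cast {c : Cmd} {reg mem reg' mem' reg'' t t'}
    (h : Runs c reg mem reg' mem' t) (hr : reg' = reg'') (ht : t = t') :
    Runs c reg mem reg'' mem' t' := by
  subst hr ht; exact h

theorem runs_const (i c : ℕ) (reg mem) :
    Runs (ins (.const i c)) reg mem (Function.update reg i c) mem 1 := .ins fun _ => rfl

theorem runs_add (i j k : ℕ) (reg mem) :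
    Runs (ins (.add i j k)) reg mem (Function.update reg i (reg j + reg k)) mem 1 :=
  .ins fun _ => rfl

theorem runs_sub (i j k : ℕ) (reg mem) :
    Runs (ins (.sub i j k)) reg mem (Function.update reg i (reg j - reg k)) mem 1 :=
  .ins fun _ => rfl

theorem runs_load (i j : ℕ) (reg mem) :
    Runs (ins (.load i j)) reg mem (Function.update reg i (mem (reg j))) mem 1 :=
  .ins fun _ => rfl

theorem runs_store (i j : ℕ) (reg mem) :
    Runs (ins (.store i j)) reg mem reg (Function.update mem (reg i) (reg j)) 1 :=
  .ins fun _ => rfl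

/-- Run `body` for the values `reg b - 1, …, 0` of `R v`, and restore `R v` afterwards; `R d` and
`R (d + 1)` are used as temporaries. -/
def forLoop (v b d : ℕ) (body : Cmd) : Cmd :=
  .seq (.ins (.add d v 0)) <| .seq (.ins (.add v b 0)) <|
    .seq (.loop v (.seq (.ins (.const (d + 1) 1)) (.seq (.ins (.sub v v (d + 1))) body)))
      (.ins (.add v d 0))

/-- The total correctness rule for `forLoop`: `I k a mem` says that the values `≥ k` of the loop
variable have been dealt with, when `a` is the contents of `R (d + 2)`. -/
theorem runs_forLoop {v b d : ℕ} {body : Cmd} {reg mem : ℕ → ℕ} {K C : ℕ}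
    (hv0 : v ≠ 0) (hvd : v < d) (hbd : b < d) (hb : reg b ≤ K) (h0 : reg 0 = 0)
    (I : ℕ → ℕ → (ℕ → ℕ) → Prop) (hI : I (reg b) (reg (d + 2)) mem)
    (hstep : ∀ k < reg b, ∀ reg₁ mem₁, I (k + 1) (reg₁ (d + 2)) mem₁ →
      (∀ r < d, reg₁ r = Function.update reg v k r) →
      ∃ reg₂ mem₂ t, Runs body reg₁ mem₁ reg₂ mem₂ t ∧ t ≤ C ∧ (∀ r ≤ d, reg₂ r = reg₁ r) ∧
        I k (reg₂ (d + 2)) mem₂) :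
    ∃ reg' mem' t, Runs (forLoop v b d body) reg mem reg' mem' t ∧
      t ≤ K * (C + 4) + 4 ∧ (∀ r < d, reg' r = reg r) ∧ I 0 (reg' (d + 2)) mem' := by
  -- State at the loop head with `k` rounds left: `R v` is `k`, and `R d` keeps the old value of `R
  -- v`. The body sees the already decremented value.
  have key : ∀ k reg₁ mem₁, k ≤ reg b → I k (reg₁ (d + 2)) mem₁ →
      (∀ r < d, reg₁ r = Function.update reg v k r) → reg₁ d = reg v →
      ∃ reg₂ mem₂ t, Runs (.loop v (.seq (.ins (.const (d + 1) 1))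
        (.seq (.ins (.sub v v (d + 1))) body))) reg₁ mem₁ reg₂ mem₂ t ∧ t ≤ k * (C + 4) + 1 ∧
        (∀ r < d, reg₂ r = Function.update reg v 0 r) ∧ reg₂ d = reg v ∧
        I 0 (reg₂ (d + 2)) mem₂ := by
    intro k
    induction k with
    | zero =>
      intro reg₁ mem₁ _ hI hr hd
      exact ⟨reg₁, mem₁, 1, .loop_done (by simp [hr v hvd]), by simp, hr, hd, hI⟩
    | succ k ih =>
      intro reg₁ mem₁ hkb hI hr hd
      have hk : reg₁ v = k + 1 := by simp [hr v hvd]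
      set reg₂ := Function.update (Function.update reg₁ (d + 1) 1) v k with hreg₂
      have hr₂ : ∀ r < d, reg₂ r = Function.update reg v k r := by
        intro r hrd
        by_cases hrv : r = v
        · simp [hreg₂, hrv]
        · rw [hreg₂, Function.update_of_ne hrv, Function.update_of_ne (by omega), hr r hrd,
            Function.update_of_ne hrv, Function.update_of_ne hrv]
      obtain ⟨reg₃, mem₃, t, hrun, ht, hpres, hI₃⟩ := hstep k (by omega) reg₂ mem₁
        (by rwa [hreg₂, Function.update_of_ne (by omega), Function.update_of_ne (by omega)]) hr₂
      have hr₃ : ∀ r < d, reg₃ r = Function.update reg v k r := fun r hrd => by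
        rw [hpres r hrd.le, hr₂ r hrd]
      obtain ⟨reg₄, mem₄, t', hrun', ht', hr₄, hd₄, hI₄⟩ := ih reg₃ mem₃ (by omega) hI₃ hr₃
        (by rw [hpres d le_rfl, hreg₂, Function.update_of_ne (by omega),
          Function.update_of_ne (by omega), hd])
      refine ⟨reg₄, mem₄, _, .loop_step (by omega) (.seq (runs_const ..) (.seq
        ((runs_sub v v (d + 1) _ _).cast ?_ rfl) hrun)) ?_ hrun', ?_, hr₄, hd₄, hI₄⟩
      · rw [hreg₂]
        congr 1
        rw [Function.update_of_ne (by omega), Function.update_self, hk]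
        rfl
      · rw [hr₃ 0 (by omega), Function.update_of_ne hv0.symm, h0]
      · linarith
  set reg₁ := Function.update (Function.update reg d (reg v)) v (reg b) with hreg₁
  obtain ⟨reg₂, mem₂, t, hrun, ht, hr₂, hd₂, hI₂⟩ := key (reg b) reg₁ mem le_rfl
    (by rwa [hreg₁, Function.update_of_ne (by omega), Function.update_of_ne (by omega)])
    (by
      intro r hrd
      by_cases hrv : r = v
      · simp [hreg₁, hrv]
      · rw [hreg₁, Function.update_of_ne hrv, Function.update_of_ne (by omega),
          Function.update_of_ne hrv])
    (by rw [hreg₁, Function.update_of_ne (by omega), Function.update_self])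
  have h02 : reg₂ 0 = 0 := by rw [hr₂ 0 (by omega), Function.update_of_ne hv0.symm, h0]
  refine ⟨Function.update reg₂ v (reg v), mem₂, _, .seq ((runs_add ..).cast ?_ rfl) (.seq
    ((runs_add v b 0 (Function.update reg d (reg v)) _).cast ?_ rfl) (.seq hrun
      ((runs_add ..).cast ?_ rfl))), ?_, ?_, ?_⟩
  · rw [h0, add_zero]
  · rw [hreg₁, Function.update_of_ne (by omega), Function.update_of_ne (by omega), h0, add_zero]
  · rw [hd₂, h02, add_zero]
  · have := Nat.mul_le_mul_right (C + 4) hb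
    linarith
  · intro r hrd
    by_cases hrv : r = v
    · rw [hrv, Function.update_self]
    · rw [Function.update_of_ne hrv, hr₂ r hrd, Function.update_of_ne hrv]
  · rwa [Function.update_of_ne (by omega)]

end Cmd

/-! ### Expressions -/

/-- Expressions over variables (which are registers) and the memory, with bounded sums. -/
inductive Expr where
  | var (i : ℕ)
  | const (c : ℕ)
  | add (a b : Expr)
  | sub (a b : Expr)
  /-- contents of the memory cell with the given address -/
  | load (a : Expr)
  /-- sum of `e` over the values of the variable `v` below the value of the variable `b` -/
  | sum (v b : ℕ) (e : Expr)

namespace Expr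

/-- The value of an expression. -/
def eval : Expr → (ℕ → ℕ) → (ℕ → ℕ) → ℕ
  | var i, ρ, _ => ρ i
  | const c, _, _ => c
  | add a b, ρ, mem => a.eval ρ mem + b.eval ρ mem
  | sub a b, ρ, mem => a.eval ρ mem - b.eval ρ mem
  | load a, ρ, mem => mem (a.eval ρ mem)
  | sum v b e, ρ, mem => ∑ x ∈ Finset.range (ρ b), e.eval (Function.update ρ v x) mem

/-- All variables are below `V`, and variable `0` is not bound. -/
def Wf (V : ℕ) : Expr → Prop
  | var i => i < V
  | const _ => True
  | add a b => a.Wf V ∧ b.Wf V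
  | sub a b => a.Wf V ∧ b.Wf V
  | load a => a.Wf V
  | sum v b e => (v ≠ 0 ∧ v < V ∧ b < V) ∧ e.Wf V

/-- Time for the evaluation, when `K` bounds the values of the variables. -/
noncomputable def cost : Expr → Polynomial ℕ
  | var _ => 1
  | const _ => 1
  | add a b => a.cost + b.cost + 1
  | sub a b => a.cost + b.cost + 1
  | load a => a.cost + 1
  | sum _ _ e => Polynomial.X * (e.cost + 1 + 4) + 6

/-- Code which puts the value of an expression into `R d` without changing registers below `d`. -/
def comp : Expr → ℕ → Cmd
  | var i, d => .ins (.add d i 0)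
  | const c, d => .ins (.const d c)
  | add a b, d => .seq (a.comp d) (.seq (b.comp (d + 1)) (.ins (.add d d (d + 1))))
  | sub a b, d => .seq (a.comp d) (.seq (b.comp (d + 1)) (.ins (.sub d d (d + 1))))
  | load a, d => .seq (a.comp d) (.ins (.load d d))
  | sum v b e, d => .seq (.ins (.const (d + 2) 0)) <|
      .seq (.forLoop v b d (.seq (e.comp (d + 3)) (.ins (.add (d + 2) (d + 2) (d + 3)))))
        (.ins (.add d (d + 2) 0))

/-- Compiled code uses the registers from `d ≥ V` on as scratch space; this shows that later
evaluations do not notice. -/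
theorem eval_congr {V : ℕ} {e : Expr} (he : e.Wf V) {ρ ρ' : ℕ → ℕ} (h : ∀ r < V, ρ r = ρ' r)
    (mem : ℕ → ℕ) : e.eval ρ mem = e.eval ρ' mem := by
  induction e generalizing ρ ρ' with
  | var i => exact h i he
  | const c => rfl
  | add a b iha ihb => simp only [eval, iha he.1 h, ihb he.2 h]
  | sub a b iha ihb => simp only [eval, iha he.1 h, ihb he.2 h]
  | load a iha => simp only [eval, iha he h]
  | sum v b e ih =>
    simp only [eval, h b he.1.2.2]
    refine Finset.sum_congr rfl fun x _ => ih he.2 fun r hr => ?_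
    simp only [Function.update_apply, h r hr]

-- Generalizing `d` lets a second operand be computed at `d + 1` while the first waits in `R d`. The
-- bound `K` survives the binding of a variable, since its values stay below that of another
-- variable.
open Cmd in
theorem runs_comp {V K : ℕ} {e : Expr} (he : e.Wf V) {d : ℕ} (hd : V ≤ d) (hV : 0 < V)
    {reg mem : ℕ → ℕ} (h0 : reg 0 = 0) (hK : ∀ r < V, reg r ≤ K) :
    ∃ reg' t, Runs (e.comp d) reg mem reg' mem t ∧ t ≤ e.cost.eval K ∧
      reg' d = e.eval reg mem ∧ ∀ r < d, reg' r = reg r := by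
  induction e generalizing d reg with
  | var i =>
    refine ⟨_, _, runs_add .., by simp [cost], by simp [eval, h0], fun r hr => ?_⟩
    rw [Function.update_of_ne hr.ne]
  | const c =>
    refine ⟨_, _, runs_const .., by simp [cost], by simp [eval], fun r hr => ?_⟩
    rw [Function.update_of_ne hr.ne]
  | add a b iha ihb =>
    obtain ⟨reg₁, t₁, hrun₁, ht₁, hv₁, hr₁⟩ := iha he.1 hd h0 hK
    obtain ⟨reg₂, t₂, hrun₂, ht₂, hv₂, hr₂⟩ := ihb (d := d + 1) (reg := reg₁) he.2 (by omega)
      (by rw [hr₁ 0 (by omega), h0]) (fun r hr => by rw [hr₁ r (by omega)]; exact hK r hr)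
    refine ⟨_, _, .seq hrun₁ (.seq hrun₂ (runs_add ..)), ?_, ?_, fun r hr => ?_⟩
    · simp only [cost, Polynomial.eval_add, Polynomial.eval_one]
      omega
    · rw [Function.update_self, hv₂, hr₂ d (by omega), hv₁, eval,
        eval_congr he.2 fun r hr => hr₁ r (by omega)]
    · rw [Function.update_of_ne hr.ne, hr₂ r (by omega), hr₁ r hr]
  | sub a b iha ihb =>
    obtain ⟨reg₁, t₁, hrun₁, ht₁, hv₁, hr₁⟩ := iha he.1 hd h0 hK
    obtain ⟨reg₂, t₂, hrun₂, ht₂, hv₂, hr₂⟩ := ihb (d := d + 1) (reg := reg₁) he.2 (by omega)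
      (by rw [hr₁ 0 (by omega), h0]) (fun r hr => by rw [hr₁ r (by omega)]; exact hK r hr)
    refine ⟨_, _, .seq hrun₁ (.seq hrun₂ (runs_sub ..)), ?_, ?_, fun r hr => ?_⟩
    · simp only [cost, Polynomial.eval_add, Polynomial.eval_one]
      omega
    · rw [Function.update_self, hv₂, hr₂ d (by omega), hv₁, eval,
        eval_congr he.2 fun r hr => hr₁ r (by omega)]
    · rw [Function.update_of_ne hr.ne, hr₂ r (by omega), hr₁ r hr]
  | load a iha =>
    obtain ⟨reg₁, t₁, hrun₁, ht₁, hv₁, hr₁⟩ := iha he hd h0 hK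
    refine ⟨_, _, .seq hrun₁ (runs_load ..), ?_, ?_, fun r hr => ?_⟩
    · simp only [cost, Polynomial.eval_add, Polynomial.eval_one]
      omega
    · rw [Function.update_self, hv₁, eval]
    · rw [Function.update_of_ne hr.ne, hr₁ r hr]
  | sum v b e ih =>
    obtain ⟨⟨hv0, hvV, hbV⟩, he⟩ := he
    have hreg : ∀ r < d, Function.update reg (d + 2) 0 r = reg r := fun r hr =>
      Function.update_of_ne (by omega) ..
    obtain ⟨reg₁, mem₁, t, hrun, ht, hr₁, hI⟩ := runs_forLoop (v := v) (b := b) (d := d)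
      (body := .seq (e.comp (d + 3)) (.ins (.add (d + 2) (d + 2) (d + 3))))
      (reg := Function.update reg (d + 2) 0) (mem := mem) (K := K) (C := e.cost.eval K + 1)
      hv0 (by omega) (by omega)
      (by rw [hreg b (by omega)]; exact hK b hbV) (by rw [hreg 0 (by omega), h0])
      -- The loop descends, so the accumulator `R (d + 2)` together with the terms still to come is
      -- always the full sum.
      (fun k a m => m = mem ∧
        a + ∑ x ∈ Finset.range k, e.eval (Function.update reg v x) mem = (sum v b e).eval reg mem)
      ⟨rfl, by rw [Function.update_self, hreg b (by omega), zero_add, eval]⟩ (by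
        rintro k hk reg₁ mem₁ ⟨rfl, hsum⟩ hreg₁
        have hreg₁' : ∀ r < d, reg₁ r = Function.update reg v k r := fun r hr => by
          simp [hreg₁ r hr, Function.update_apply, show r ≠ d + 2 by omega]
        rw [hreg b (by omega)] at hk
        obtain ⟨reg₂, t₂, hrun₂, ht₂, hv₂, hr₂⟩ := ih (d := d + 3) (reg := reg₁) he (by omega)
          (by rw [hreg₁' 0 (by omega), Function.update_of_ne hv0.symm, h0]) (fun r hr => by
            rw [hreg₁' r (by omega), Function.update_apply]
            split
            · exact hk.le.trans (hK b hbV)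
            · exact hK r hr)
        refine ⟨_, _, _, .seq hrun₂ (runs_add ..), by omega, fun r hr => ?_, rfl, ?_⟩
        · rw [Function.update_of_ne (by omega), hr₂ r (by omega)]
        · rw [Function.update_self, hv₂, hr₂ _ (by omega),
            eval_congr he fun r hr => hreg₁' r (by omega), ← hsum, Finset.sum_range_succ]
          ring)
    obtain ⟨rfl, hI⟩ := hI
    refine ⟨_, _, .seq (runs_const ..) (.seq hrun (runs_add ..)), ?_, ?_, fun r hr => ?_⟩
    · simp only [cost, Polynomial.eval_add, Polynomial.eval_one, Polynomial.eval_mul,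
        Polynomial.eval_X, Polynomial.eval_ofNat]
      omega
    · rw [Function.update_self, hr₁ 0 (by omega), hreg 0 (by omega), h0, ← hI]
      simp
    · rw [Function.update_of_ne hr.ne, hr₁ r hr, hreg r hr]

end Expr

/-! ### Programs with bounded loops -/

/-- Programs over the memory, with bounded loops. -/
inductive Prog where
  /-- `M a := e` -/
  | store (a e : Expr)
  | seq (p q : Prog)
  /-- run `p` for all values of the variable `v` below the value of the variable `b`, in
  descending order -/
  | loop (v b : ℕ) (p : Prog)

namespace Prog

/-- The effect of a program on the memory. -/
def eval : Prog → (ℕ → ℕ) → (ℕ → ℕ) → (ℕ → ℕ)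
  | store a e, ρ, mem => Function.update mem (a.eval ρ mem) (e.eval ρ mem)
  | seq p q, ρ, mem => q.eval ρ (p.eval ρ mem)
  | loop v b p, ρ, mem =>
    Nat.rec (motive := fun _ => (ℕ → ℕ) → (ℕ → ℕ)) id
      (fun x f mem => f (p.eval (Function.update ρ v x) mem)) (ρ b) mem

/-- All variables are below `V`, and variable `0` is not bound. -/
def Wf (V : ℕ) : Prog → Prop
  | store a e => a.Wf V ∧ e.Wf V
  | seq p q => p.Wf V ∧ q.Wf V
  | loop v b p => (v ≠ 0 ∧ v < V ∧ b < V) ∧ p.Wf V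

/-- Running time, when `K` bounds the values of the variables. -/
noncomputable def cost : Prog → Polynomial ℕ
  | store a e => a.cost + e.cost + 1
  | seq p q => p.cost + q.cost
  | loop _ _ p => Polynomial.X * (p.cost + 4) + 4

/-- Compiled code, which does not change registers below `d`. -/
def comp : Prog → ℕ → Cmd
  | store a e, d => .seq (a.comp d) (.seq (e.comp (d + 1)) (.ins (.store d (d + 1))))
  | seq p q, d => .seq (p.comp d) (q.comp d)
  | loop v b p, d => .forLoop v b d (p.comp (d + 1))

theorem eval_congr {V : ℕ} {p : Prog} (hp : p.Wf V) {ρ ρ' : ℕ → ℕ} (h : ∀ r < V, ρ r = ρ' r)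
    (mem : ℕ → ℕ) : p.eval ρ mem = p.eval ρ' mem := by
  induction p generalizing ρ ρ' mem with
  | store a e => simp only [eval, Expr.eval_congr hp.1 h, Expr.eval_congr hp.2 h]
  | seq p q ihp ihq => simp only [eval, ihp hp.1 h, ihq hp.2 h]
  | loop v b p ih =>
    simp only [eval, h b hp.1.2.2]
    generalize ρ' b = n
    induction n generalizing mem with
    | zero => rfl
    | succ n ihn =>
      have e : p.eval (Function.update ρ v n) mem = p.eval (Function.update ρ' v n) mem :=
        ih hp.2 (fun r hr => by simp only [Function.update_apply, h r hr]) mem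
      simp only [e, ihn]

-- The time bound depends only on the values of the variables, because memory contents never control
-- a loop.
open Cmd in
theorem runs_comp {V K : ℕ} {p : Prog} (hp : p.Wf V) {d : ℕ} (hd : V ≤ d) (hV : 0 < V)
    {reg mem : ℕ → ℕ} (h0 : reg 0 = 0) (hK : ∀ r < V, reg r ≤ K) :
    ∃ reg' t, Runs (p.comp d) reg mem reg' (p.eval reg mem) t ∧ t ≤ p.cost.eval K ∧
      ∀ r < d, reg' r = reg r := by
  induction p generalizing d reg mem with
  | store a e =>
    obtain ⟨reg₁, t₁, hrun₁, ht₁, hv₁, hr₁⟩ := Expr.runs_comp (mem := mem) hp.1 hd hV h0 hK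
    obtain ⟨reg₂, t₂, hrun₂, ht₂, hv₂, hr₂⟩ := Expr.runs_comp (d := d + 1) (reg := reg₁)
      (mem := mem) (K := K) hp.2 (by omega) hV
      (by rw [hr₁ 0 (by omega), h0]) (fun r hr => by rw [hr₁ r (by omega)]; exact hK r hr)
    have hst := runs_store d (d + 1) reg₂ mem
    rw [hv₂, hr₂ d (by omega), hv₁, Expr.eval_congr hp.2 fun r hr => hr₁ r (by omega)] at hst
    refine ⟨_, _, .seq hrun₁ (.seq hrun₂ hst), ?_, fun r hr => ?_⟩
    · simp only [cost, Polynomial.eval_add, Polynomial.eval_one]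
      omega
    · rw [hr₂ r (by omega), hr₁ r hr]
  | seq p q ihp ihq =>
    obtain ⟨reg₁, t₁, hrun₁, ht₁, hr₁⟩ := ihp (mem := mem) hp.1 hd h0 hK
    obtain ⟨reg₂, t₂, hrun₂, ht₂, hr₂⟩ := ihq (d := d) (reg := reg₁) (mem := p.eval reg mem) hp.2 hd
      (by rw [hr₁ 0 (by omega), h0]) (fun r hr => by rw [hr₁ r (by omega)]; exact hK r hr)
    rw [eval_congr hp.2 fun r hr => hr₁ r (by omega)] at hrun₂
    refine ⟨_, _, .seq hrun₁ hrun₂, ?_, fun r hr => ?_⟩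
    · simp only [cost, Polynomial.eval_add]
      omega
    · rw [hr₂ r hr, hr₁ r hr]
  | loop v b p ih =>
    obtain ⟨⟨hv0, hvV, hbV⟩, hp⟩ := hp
    obtain ⟨reg₁, mem₁, t, hrun, ht, hr₁, hI⟩ := runs_forLoop (v := v) (b := b) (d := d)
      (body := p.comp (d + 1)) (reg := reg) (mem := mem) (K := K) (C := p.cost.eval K)
      hv0 (by omega) (by omega) (hK b hbV) h0
      -- Invariant: performing the remaining `k` rounds on the current memory yields the final
      -- memory.
      (fun k _ m => Nat.rec (motive := fun _ => (ℕ → ℕ) → (ℕ → ℕ)) id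
        (fun x f mem => f (p.eval (Function.update reg v x) mem)) k m = (loop v b p).eval reg mem)
      rfl (by
        intro k hk reg₁ mem₁ hI hreg₁
        obtain ⟨reg₂, t₂, hrun₂, ht₂, hr₂⟩ := ih (d := d + 1) (reg := reg₁) (mem := mem₁) hp
          (by omega) (by rw [hreg₁ 0 (by omega), Function.update_of_ne hv0.symm, h0])
          (fun r hr => by
            rw [hreg₁ r (by omega), Function.update_apply]
            split
            · exact hk.le.trans (hK b hbV)
            · exact hK r hr)
        refine ⟨_, _, _, hrun₂, ht₂, fun r hr => hr₂ r (by omega), ?_⟩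
        rw [eval_congr hp fun r hr => hreg₁ r (by omega), ← hI])
    replace hI : mem₁ = _ := hI
    rw [hI] at hrun
    refine ⟨_, _, hrun, ?_, hr₁⟩
    simpa only [cost, Polynomial.eval_add, Polynomial.eval_mul,
        Polynomial.eval_X, Polynomial.eval_ofNat] using ht

/-- The invariant rule for loops. -/
theorem eval_loop_induction {v b : ℕ} {p : Prog} {ρ : ℕ → ℕ} (I : ℕ → (ℕ → ℕ) → Prop) {k : ℕ}
    {mem : ℕ → ℕ} (h : I k mem)
    (hstep : ∀ i mem, ∀ x < ρ b, I i mem → I (i + 1) (p.eval (Function.update ρ v x) mem)) :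
    I (k + ρ b) ((loop v b p).eval ρ mem) := by
  simp only [eval]
  have : ∀ n ≤ ρ b, ∀ k mem, I k mem →
      I (k + n) (Nat.rec (motive := fun _ => (ℕ → ℕ) → (ℕ → ℕ)) id
        (fun x f mem => f (p.eval (Function.update ρ v x) mem)) n mem) := by
    intro n
    induction n with
    | zero => exact fun _ _ _ h => h
    | succ n ih =>
      intro hn k mem h
      have := ih (by omega) (k + 1) _ (hstep k mem n (by omega) h)
      rwa [add_right_comm] at this
  exact this _ le_rfl _ _ h

end Prog
end RAM

/-! ### Iterations which become stationary -/

/-- Each round that changes something raises the bounded measure `μ`, so at most `n` rounds do. -/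
theorem iterate_stationary {β : Type*} {G : β → β} {μ : β → ℕ} {n : ℕ} (hμ : ∀ x, μ x ≤ n)
    (hG : ∀ x, G x ≠ x → μ x < μ (G x)) (x : β) {k : ℕ} (hk : n ≤ k) :
    G (G^[k] x) = G^[k] x := by
  have key : ∀ j, G (G^[j] x) = G^[j] x ∨ j + 1 ≤ μ (G^[j + 1] x) := by
    intro j
    induction j with
    | zero =>
      by_cases h : G x = x
      · exact .inl h
      · right
        have := hG x h
        simp only [zero_add, Function.iterate_one]
        omega
    | succ j ih =>
      by_cases h : G (G^[j + 1] x) = G^[j + 1] x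
      · exact .inl h
      · right
        rcases ih with ih | ih
        · rw [Function.iterate_succ_apply'] at h
          exact absurd (congrArg G ih) h
        · have := hG _ h
          rw [Function.iterate_succ_apply' G (j + 1)]
          omega
  rcases key k with h | h
  · exact h
  · have := hμ (G^[k + 1] x)
    omega

/-- The elements at distance at most `k` from a set in a directed graph. -/
def reachLevel {ι : Type*} (E : ι → ι → Prop) (S : Set ι) (k : ℕ) : Set ι :=
  (fun X => {y | y ∈ X ∨ ∃ x ∈ X, E x y})^[k] S

theorem mem_reachLevel_zero {ι : Type*} {E : ι → ι → Prop} {S : Set ι} {y : ι} :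
    y ∈ reachLevel E S 0 ↔ y ∈ S := Iff.rfl

theorem mem_reachLevel_succ {ι : Type*} {E : ι → ι → Prop} {S : Set ι} {k : ℕ} {y : ι} :
    y ∈ reachLevel E S (k + 1) ↔ y ∈ reachLevel E S k ∨ ∃ x ∈ reachLevel E S k, E x y := by
  unfold reachLevel
  rw [Function.iterate_succ_apply']
  rfl

/-- The levels increase, and their cardinality is a measure for `iterate_stationary`; the stationary
level is closed under `E`. -/
theorem mem_reachLevel_iff {ι : Type*} [Finite ι] {E : ι → ι → Prop} {S : Set ι} {k : ℕ}
    (hk : Nat.card ι ≤ k) {y : ι} :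
    y ∈ reachLevel E S k ↔ ∃ x ∈ S, Relation.ReflTransGen E x y := by
  constructor
  · clear hk
    induction k generalizing y with
    | zero => exact fun h => ⟨y, h, .refl⟩
    | succ k ih =>
      rw [mem_reachLevel_succ]
      rintro (h | ⟨x, hx, hxy⟩)
      · exact ih h
      · obtain ⟨s, hs, hsx⟩ := ih hx
        exact ⟨s, hs, hsx.tail hxy⟩
  · rintro ⟨x, hx, hxy⟩
    have hst : reachLevel E S (k + 1) = reachLevel E S k := by
      unfold reachLevel
      rw [Function.iterate_succ_apply']
      refine iterate_stationary (G := fun X => {y | y ∈ X ∨ ∃ x ∈ X, E x y}) (μ := Set.ncard) (n := Nat.card ι)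
        (fun X => ?_) (fun X hX => ?_) S hk
      · rw [← Set.ncard_univ]
        exact Set.ncard_le_ncard (Set.subset_univ _) Set.finite_univ
      · exact Set.ncard_lt_ncard
          (lt_of_le_of_ne (fun _ h => Or.inl h) (Ne.symm hX)) (Set.toFinite _)
    induction hxy with
    | refl =>
      have : ∀ j, x ∈ reachLevel E S j := by
        intro j
        induction j with
        | zero => exact hx
        | succ j ih => exact mem_reachLevel_succ.2 (.inl ih)
      exact this k
    | tail _ h ih =>
      rw [← hst]
      exact mem_reachLevel_succ.2 (.inr ⟨_, ih, h⟩)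

/-! ### Paths -/

namespace NFA

variable {α σ : Type*} {A : NFA α σ}

theorem HasPath.nil (p : σ) : A.HasPath p p [] := ⟨.nil p⟩

theorem HasPath.cons {p q r : σ} {a : α} {u : List α} (h : q ∈ A.step p a)
    (hu : A.HasPath q r u) : A.HasPath p r (a :: u) :=
  hu.map fun P => .cons _ _ _ _ _ h P

theorem HasPath.append {p q r : σ} {u v : List α} (hu : A.HasPath p q u)
    (hv : A.HasPath q r v) : A.HasPath p r (u ++ v) := by
  obtain ⟨P⟩ := hu
  induction P with
  | nil => exact hv
  | cons t s q a x h _ ih => exact (ih hv).cons h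

theorem HasPathSubset.refl (p : σ) (B : Set α) : A.HasPathSubset p p B :=
  ⟨[], .nil p, by simp⟩

theorem HasPathSubset.trans {p q r : σ} {B : Set α} (h : A.HasPathSubset p q B)
    (h' : A.HasPathSubset q r B) : A.HasPathSubset p r B := by
  obtain ⟨u, hu, huB⟩ := h
  obtain ⟨v, hv, hvB⟩ := h'
  refine ⟨u ++ v, hu.append hv, fun a ha => ?_⟩
  rcases List.mem_append.1 ha with ha | ha
  exacts [huB ha, hvB ha]

theorem HasPathSubset.mono {p q : σ} {B B' : Set α} (h : A.HasPathSubset p q B) (hB : B ⊆ B') :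
    A.HasPathSubset p q B' := by
  obtain ⟨u, hu, huB⟩ := h
  exact ⟨u, hu, huB.trans hB⟩

theorem HasPathSubset.eq_of_empty {p q : σ} (h : A.HasPathSubset p q ∅) : p = q := by
  obtain ⟨u, ⟨P⟩, huB⟩ := h
  cases P with
  | nil => rfl
  | cons => exact absurd (huB List.mem_cons_self) (Set.notMem_empty _)

theorem hasPathSubset_iff {p q : σ} {B : Set α} :
    A.HasPathSubset p q B ↔
      Relation.ReflTransGen (fun p q => ∃ a ∈ B, q ∈ A.step p a) p q := by
  constructor
  · rintro ⟨u, ⟨P⟩, huB⟩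
    induction P with
    | nil => exact .refl
    | cons t s q a x h _ ih =>
      exact .head ⟨a, huB List.mem_cons_self, h⟩ (ih fun b hb => huB (List.mem_cons_of_mem _ hb))
  · intro h
    induction h with
    | refl => exact .refl ..
    | tail _ h ih =>
      obtain ⟨a, ha, h⟩ := h
      exact ih.trans ⟨[a], (HasPath.nil _).cons h, by simpa using ha⟩

/-- The letters on loops around `c` which are labelled over `B`, possibly except for that letter. -/
def loopLetters (A : NFA α σ) (c : σ) (B : Set α) : Set α :=
  {a | ∃ p q, A.HasPathSubset c p B ∧ q ∈ A.step p a ∧ A.HasPathSubset q c B}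

/-- Cut the path at an occurrence of `a`. -/
theorem subset_loopLetters {u : List α} {p q : σ} (h : A.HasPath p q u) {B : Set α}
    (huB : {a | a ∈ u} ⊆ B) {a : α} (ha : a ∈ u) :
    ∃ r s, A.HasPathSubset p r B ∧ s ∈ A.step r a ∧ A.HasPathSubset s q B := by
  obtain ⟨P⟩ := h
  induction P with
  | nil => simp at ha
  | cons t s q b x h P ih =>
    have hb : b ∈ B := huB List.mem_cons_self
    have hxB : {a | a ∈ x} ⊆ B := fun c hc => huB (List.mem_cons_of_mem _ hc)
    rcases List.mem_cons.1 ha with rfl | ha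
    · exact ⟨s, t, .refl .., h, x, ⟨P⟩, hxB⟩
    · obtain ⟨r, r', h₁, h₂, h₃⟩ := ih hxB ha
      exact ⟨r, r', .trans ⟨[b], (HasPath.nil _).cons h, by simpa using hb⟩ h₁, h₂, h₃⟩

theorem HasPathEq.subset_loopLetters {c : σ} {B B' : Set α} (h : A.HasPathEq c c B)
    (hB : B ⊆ B') : B ⊆ A.loopLetters c B' := by
  obtain ⟨u, hu, rfl⟩ := h
  exact fun a ha => NFA.subset_loopLetters hu hB ha

/-- Concatenate one loop for each letter of `B`. The induction over finite `F ⊆ B` collects the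
letters of `F` while all labels stay in `B`. -/
theorem hasPathEq_of_subset_loopLetters [Finite α] {c : σ} {B : Set α}
    (h : B ⊆ A.loopLetters c B) : A.HasPathEq c c B := by
  have : ∀ F : Set α, F.Finite → F ⊆ B →
      ∃ u, A.HasPath c c u ∧ F ⊆ {a | a ∈ u} ∧ {a | a ∈ u} ⊆ B := by
    intro F hF
    induction F, hF using Set.Finite.induction_on with
    | empty => exact fun _ => ⟨[], .nil c, by simp, by simp⟩
    | @insert a F _ _ ih =>
      intro hFB
      obtain ⟨u, hu, hFu, huB⟩ := ih ((Set.subset_insert a F).trans hFB)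
      obtain ⟨p, q, ⟨v, hv, hvB⟩, hpq, ⟨w, hw, hwB⟩⟩ := h (hFB (Set.mem_insert a F))
      refine ⟨v ++ a :: w ++ u, (hv.append (hw.cons hpq)).append hu, ?_, ?_⟩
      · rintro b (rfl | hb)
        · simp
        · exact List.mem_append_right _ (hFu hb)
      · intro b hb
        simp only [Set.mem_ofPred_eq, List.mem_append, List.mem_cons] at hb
        rcases hb with (hb | rfl | hb) | hb
        exacts [hvB hb, hFB (Set.mem_insert b F), hwB hb, huB hb]
  obtain ⟨u, hu, h₁, h₂⟩ := this B (Set.toFinite B) subset_rfl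
  exact ⟨u, hu, h₂.antisymm h₁⟩

end NFA

/-! ### Witnesses and reachability -/

section Witness

variable {α σ₁ σ₂ : Type*} (A₁ : NFA α σ₁) (A₂ : NFA α σ₂)

/-- Decreasing approximations of the greatest alphabet which labels a loop around `c₁` and a loop
around `c₂`. -/
def letterLevel (c₁ : σ₁) (c₂ : σ₂) (k : ℕ) : Set α :=
  (fun X => {a | a ∈ X ∧ a ∈ A₁.loopLetters c₁ X ∧ a ∈ A₂.loopLetters c₂ X})^[k] Set.univ

variable {A₁ A₂}

theorem mem_letterLevel_succ {c₁ : σ₁} {c₂ : σ₂} {k : ℕ} {a : α} :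
    a ∈ letterLevel A₁ A₂ c₁ c₂ (k + 1) ↔ a ∈ letterLevel A₁ A₂ c₁ c₂ k ∧
      a ∈ A₁.loopLetters c₁ (letterLevel A₁ A₂ c₁ c₂ k) ∧
      a ∈ A₂.loopLetters c₂ (letterLevel A₁ A₂ c₁ c₂ k) := by
  unfold letterLevel
  rw [Function.iterate_succ_apply']
  rfl

/-- The refinement is monotone and removes nothing from `B` itself, so `B` stays below every
iterate. -/
theorem subset_letterLevel {c₁ : σ₁} {c₂ : σ₂} {B : Set α} (h₁ : A₁.HasPathEq c₁ c₁ B)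
    (h₂ : A₂.HasPathEq c₂ c₂ B) (k : ℕ) : B ⊆ letterLevel A₁ A₂ c₁ c₂ k := by
  induction k with
  | zero => exact Set.subset_univ _
  | succ k ih =>
    exact fun a ha => mem_letterLevel_succ.2
      ⟨ih ha, h₁.subset_loopLetters ih ha, h₂.subset_loopLetters ih ha⟩

theorem letterLevel_stationary [Finite α] (c₁ : σ₁) (c₂ : σ₂) {k : ℕ} (hk : Nat.card α ≤ k) :
    letterLevel A₁ A₂ c₁ c₂ (k + 1) = letterLevel A₁ A₂ c₁ c₂ k := by
  unfold letterLevel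
  rw [Function.iterate_succ_apply']
  refine iterate_stationary
    (G := fun X => {a | a ∈ X ∧ a ∈ A₁.loopLetters c₁ X ∧ a ∈ A₂.loopLetters c₂ X})
    -- The alphabets shrink, so the number of discarded letters is what grows.
    (μ := fun X => Xᶜ.ncard) (n := Nat.card α) (fun X => ?_)
    (fun X hX => ?_) Set.univ hk
  · rw [← Set.ncard_univ]
    exact Set.ncard_le_ncard (Set.subset_univ _) Set.finite_univ
  · refine Set.ncard_lt_ncard ?_ (Set.toFinite _)
    exact compl_lt_compl_iff_lt.2 (lt_of_le_of_ne (fun _ h => h.1) hX)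

theorem hasPathEq_letterLevel [Finite α] (c₁ : σ₁) (c₂ : σ₂) {k : ℕ} (hk : Nat.card α ≤ k) :
    A₁.HasPathEq c₁ c₁ (letterLevel A₁ A₂ c₁ c₂ k) ∧
      A₂.HasPathEq c₂ c₂ (letterLevel A₁ A₂ c₁ c₂ k) := by
  have h := letterLevel_stationary (A₁ := A₁) (A₂ := A₂) c₁ c₂ hk
  constructor <;> refine NFA.hasPathEq_of_subset_loopLetters fun a ha => ?_ <;>
    rw [← h, mem_letterLevel_succ] at ha
  exacts [ha.2.1, ha.2.2]

variable (A₁ A₂) in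
/-- One step of a pair of `(u, B)`-paths: reading a letter, or passing through loops around some
`c₁` and `c₂` with the alphabet `L c₁ c₂`. -/
def PairStep (L : σ₁ → σ₂ → Set α) (x y : σ₁ × σ₂) : Prop :=
  (∃ a, y.1 ∈ A₁.step x.1 a ∧ y.2 ∈ A₂.step x.2 a) ∨
    ∃ c₁ c₂, (A₁.HasPathSubset x.1 c₁ (L c₁ c₂) ∧ A₁.HasPathSubset c₁ y.1 (L c₁ c₂)) ∧
      (A₂.HasPathSubset x.2 c₂ (L c₁ c₂) ∧ A₂.HasPathSubset c₂ y.2 (L c₁ c₂))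

/-- A `(u, B)`-path from `x` to `y`. -/
def NFA.UBPathFrom {σ : Type*} (A : NFA α σ) (π : FactorizationPair α) (x y : σ) : Prop :=
  ∃ (s t : Fin (π.p + 1) → σ) (c : Fin π.p → σ),
    s 0 = x ∧ t (Fin.last π.p) = y ∧
    (∀ i, A.HasPath (s i) (t i) (π.u i)) ∧
    ∀ i : Fin π.p,
      A.HasPathSubset (t i.castSucc) (c i) (π.B i) ∧
      A.HasPathEq (c i) (c i) (π.B i) ∧
      A.HasPathSubset (c i) (s i.succ) (π.B i)

theorem NFA.hasUBPath_iff {σ : Type*} {A : NFA α σ} {π : FactorizationPair α} :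
    A.HasUBPath π ↔ ∃ x ∈ A.start, ∃ y ∈ A.accept, A.UBPathFrom π x y := by
  constructor
  · rintro ⟨s, t, c, hs, ht, h⟩
    exact ⟨_, hs, _, ht, s, t, c, rfl, rfl, h⟩
  · rintro ⟨_, hs, _, ht, s, t, c, rfl, rfl, h⟩
    exact ⟨s, t, c, hs, ht, h⟩

/-- The factorization pair with `p = 0` and `u 0 = []`. -/
def FactorizationPair.nil : FactorizationPair α where
  p := 0
  u _ := []
  B i := i.elim0
  nonempty i := i.elim0

/-- Prepend a letter to `u 0`. -/
def FactorizationPair.consLetter (a : α) (π : FactorizationPair α) : FactorizationPair α where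
  p := π.p
  u := Fin.cons (a :: π.u 0) (fun i => π.u i.succ)
  B := π.B
  nonempty := π.nonempty

/-- Prepend the empty word and an alphabet. -/
def FactorizationPair.consAlphabet (B : Set α) (hB : B.Nonempty) (π : FactorizationPair α) :
    FactorizationPair α where
  p := π.p + 1
  u := Fin.cons [] π.u
  B := Fin.cons B π.B
  nonempty := Fin.cases hB π.nonempty

namespace NFA

variable {σ : Type*} {A : NFA α σ} {π : FactorizationPair α}

theorem UBPathFrom.nil (x : σ) : A.UBPathFrom .nil x x :=
  ⟨fun _ => x, fun _ => x, fun i => i.elim0, rfl, rfl, fun _ => .nil x, fun i => i.elim0⟩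

theorem UBPathFrom.consLetter {x y z : σ} {a : α} (h : y ∈ A.step x a)
    (hy : A.UBPathFrom π y z) : A.UBPathFrom (π.consLetter a) x z := by
  obtain ⟨s, t, c, rfl, rfl, h₁, h₂⟩ := hy
  refine ⟨Fin.cons x (fun i => s i.succ), t, c, rfl, rfl, ?_, fun i => ?_⟩
  · exact Fin.cases ((h₁ 0).cons h) (fun i => h₁ i.succ)
  · exact h₂ i

theorem UBPathFrom.consAlphabet {x y z c : σ} {B : Set α} (hB : B.Nonempty)
    (h₁ : A.HasPathSubset x c B) (h₂ : A.HasPathEq c c B) (h₃ : A.HasPathSubset c y B)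
    (hy : A.UBPathFrom π y z) : A.UBPathFrom (π.consAlphabet B hB) x z := by
  obtain ⟨s, t, d, rfl, rfl, h₁', h₂'⟩ := hy
  refine ⟨Fin.cons x s, Fin.cons x t, Fin.cons c d, rfl, rfl, ?_, ?_⟩
  · exact Fin.cases (.nil x) h₁'
  · exact Fin.cases ⟨h₁, h₂, h₃⟩ h₂'

end NFA

/-- Each edge prepends a letter or an alphabet to the witness. A factorization pair admits no empty
alphabet, but an edge over an empty one does not move and is left out. -/
theorem exists_ubPathFrom_of_reflTransGen [Finite α] {k : ℕ} (hk : Nat.card α ≤ k)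
    {x y : σ₁ × σ₂}
    (h : Relation.ReflTransGen (PairStep A₁ A₂ fun c₁ c₂ => letterLevel A₁ A₂ c₁ c₂ k) x y) :
    ∃ π, A₁.UBPathFrom π x.1 y.1 ∧ A₂.UBPathFrom π x.2 y.2 := by
  induction h using Relation.ReflTransGen.head_induction_on with
  | refl => exact ⟨.nil, .nil _, .nil _⟩
  | @head x z h _ ih =>
    obtain ⟨π, h₁, h₂⟩ := ih
    rcases h with ⟨a, ha₁, ha₂⟩ | ⟨c₁, c₂, ⟨h₁', h₁''⟩, ⟨h₂', h₂''⟩⟩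
    · exact ⟨π.consLetter a, h₁.consLetter ha₁, h₂.consLetter ha₂⟩
    · obtain ⟨e₁, e₂⟩ := hasPathEq_letterLevel (A₁ := A₁) (A₂ := A₂) c₁ c₂ hk
      rcases (letterLevel A₁ A₂ c₁ c₂ k).eq_empty_or_nonempty with hB | hB
      · simp only [hB] at h₁' h₁'' h₂' h₂''
        rw [h₁'.eq_of_empty, h₁''.eq_of_empty, h₂'.eq_of_empty, h₂''.eq_of_empty]
        exact ⟨π, h₁, h₂⟩
      · exact ⟨_, h₁.consAlphabet hB h₁' e₁ h₁'', h₂.consAlphabet hB h₂' e₂ h₂''⟩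

theorem NFA.HasPath.pair_reflTransGen {L : σ₁ → σ₂ → Set α} {p₁ q₁ : σ₁} {p₂ q₂ : σ₂}
    {u : List α} (h₁ : A₁.HasPath p₁ q₁ u) (h₂ : A₂.HasPath p₂ q₂ u) :
    Relation.ReflTransGen (PairStep A₁ A₂ L) (p₁, p₂) (q₁, q₂) := by
  obtain ⟨P⟩ := h₁
  obtain ⟨Q⟩ := h₂
  induction P generalizing p₂ with
  | nil => cases Q; exact .refl
  | cons t s q a x h P ih =>
    cases Q with
    | cons t' _ _ _ _ h' Q => exact .head (b := (t, t')) (.inl ⟨a, h, h'⟩) (ih Q)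

/-- Each `B i` is contained in `letterLevel` at `(c i, c' i)` for every `k`, so this direction needs
no lower bound on `k`. -/
theorem reflTransGen_of_ubPathFrom (k : ℕ) {π : FactorizationPair α} {x y : σ₁ × σ₂}
    (h₁ : A₁.UBPathFrom π x.1 y.1) (h₂ : A₂.UBPathFrom π x.2 y.2) :
    Relation.ReflTransGen (PairStep A₁ A₂ fun c₁ c₂ => letterLevel A₁ A₂ c₁ c₂ k) x y := by
  obtain ⟨s, t, c, hs, ht, hu, hB⟩ := h₁
  obtain ⟨s', t', c', hs', ht', hu', hB'⟩ := h₂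
  have key : ∀ i : Fin (π.p + 1), Relation.ReflTransGen
      (PairStep A₁ A₂ fun c₁ c₂ => letterLevel A₁ A₂ c₁ c₂ k) x (t i, t' i) := by
    intro i
    induction i using Fin.induction with
    | zero =>
      rw [show x = (s 0, s' 0) by rw [hs, hs']]
      exact (hu 0).pair_reflTransGen (hu' 0)
    | succ i ih =>
      obtain ⟨b₁, b₂, b₃⟩ := hB i
      obtain ⟨b₁', b₂', b₃'⟩ := hB' i
      have hsub := subset_letterLevel b₂ b₂' k
      exact (ih.tail (c := (s i.succ, s' i.succ)) (.inr ⟨c i, c' i,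
        ⟨b₁.mono hsub, b₃.mono hsub⟩, ⟨b₁'.mono hsub, b₃'.mono hsub⟩⟩)).trans
        ((hu i.succ).pair_reflTransGen (hu' i.succ))
  have := key (Fin.last π.p)
  rwa [ht, ht'] at this

theorem exists_isNonPTSepWitness_iff [Finite α] [Finite σ₁] [Finite σ₂] {k n : ℕ}
    (hk : Nat.card α ≤ k) (hn : Nat.card (σ₁ × σ₂) ≤ n) :
    (∃ π, IsNonPTSepWitness A₁ A₂ π) ↔
      ∃ y ∈ reachLevel (PairStep A₁ A₂ fun c₁ c₂ => letterLevel A₁ A₂ c₁ c₂ k)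
        {x | x.1 ∈ A₁.start ∧ x.2 ∈ A₂.start} n, y.1 ∈ A₁.accept ∧ y.2 ∈ A₂.accept := by
  simp only [IsNonPTSepWitness, NFA.hasUBPath_iff, mem_reachLevel_iff hn]
  constructor
  · rintro ⟨π, ⟨x₁, hx₁, y₁, hy₁, h₁⟩, ⟨x₂, hx₂, y₂, hy₂, h₂⟩⟩
    exact ⟨(y₁, y₂), ⟨(x₁, x₂), ⟨hx₁, hx₂⟩, reflTransGen_of_ubPathFrom k h₁ h₂⟩, hy₁, hy₂⟩
  · rintro ⟨y, ⟨x, ⟨hx₁, hx₂⟩, h⟩, hy₁, hy₂⟩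
    obtain ⟨π, h₁, h₂⟩ := exists_ubPathFrom_of_reflTransGen hk h
    exact ⟨π, ⟨_, hx₁, _, hy₁, h₁⟩, ⟨_, hx₂, _, hy₂, h₂⟩⟩

end Witness

namespace RAM

/-! ### Tables in the memory -/

/-- Address of an entry of a four-dimensional table of side length `N`. -/
def addr (N t x₀ x₁ x₂ x₃ : ℕ) : ℕ := (((t * N + x₀) * N + x₁) * N + x₂) * N + x₃

/-- Addresses are numbers in base `N` with the table number in front, so entries do not collide. -/
theorem addr_digits {N t x₀ x₁ x₂ x₃ : ℕ} (h₀ : x₀ < N) (h₁ : x₁ < N) (h₂ : x₂ < N) (h₃ : x₃ < N) :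
    addr N t x₀ x₁ x₂ x₃ % N = x₃ ∧ addr N t x₀ x₁ x₂ x₃ / N % N = x₂ ∧
      addr N t x₀ x₁ x₂ x₃ / N / N % N = x₁ ∧ addr N t x₀ x₁ x₂ x₃ / N / N / N % N = x₀ ∧
      addr N t x₀ x₁ x₂ x₃ / N / N / N / N = t := by
  have hd : ∀ q x, x < N → (q * N + x) / N = q := fun q x hx => by
    rw [add_comm, Nat.add_mul_div_right _ _ (by omega), Nat.div_eq_of_lt hx, zero_add]
  have hm : ∀ q x, x < N → (q * N + x) % N = x := fun q x hx => by
    rw [add_comm, Nat.add_mul_mod_self_right, Nat.mod_eq_of_lt hx]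
  unfold addr
  rw [hm _ _ h₃, hd _ _ h₃, hm _ _ h₂, hd _ _ h₂, hm _ _ h₁, hd _ _ h₁, hm _ _ h₀, hd _ _ h₀]
  simp

/-- The space of table `0` is reserved for the input. -/
theorem pow_le_addr {N t x₀ x₁ x₂ x₃ : ℕ} (ht : 1 ≤ t) : N ^ 4 ≤ addr N t x₀ x₁ x₂ x₃ := by
  unfold addr
  calc N ^ 4 = (((1 * N + 0) * N + 0) * N + 0) * N + 0 := by ring
    _ ≤ _ := by gcongr <;> omega

/-- The addresses of the entries of a table. -/
def region (N t : ℕ) : Set ℕ :=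
  {a | ∃ x₀ < N, ∃ x₁ < N, ∃ x₂ < N, ∃ x₃ < N, a = addr N t x₀ x₁ x₂ x₃}

theorem notMem_region {N t t' x₀ x₁ x₂ x₃ : ℕ} (ht : t' ≠ t) (h₀ : x₀ < N) (h₁ : x₁ < N)
    (h₂ : x₂ < N) (h₃ : x₃ < N) : addr N t' x₀ x₁ x₂ x₃ ∉ region N t := by
  rintro ⟨y₀, g₀, y₁, g₁, y₂, g₂, y₃, g₃, h⟩
  have := (addr_digits (t := t') h₀ h₁ h₂ h₃).2.2.2.2
  rw [h, (addr_digits g₀ g₁ g₂ g₃).2.2.2.2] at this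
  exact ht this.symm

theorem notMem_region_of_lt {N t a : ℕ} (ht : 1 ≤ t) (ha : a < N ^ 4) : a ∉ region N t := by
  rintro ⟨y₀, g₀, y₁, g₁, y₂, g₂, y₃, g₃, rfl⟩
  exact absurd (pow_le_addr ht) (not_le.2 ha)

/-- The memories agree on the input and on all tables from number `2` on, except for table `t`. -/
def SameExcept (N t : ℕ) (mem mem' : ℕ → ℕ) : Prop :=
  (∀ a < N ^ 4, mem' a = mem a) ∧ ∀ t' ≥ 2, t' ≠ t → ∀ x₀ < N, ∀ x₁ < N, ∀ x₂ < N, ∀ x₃ < N,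
    mem' (addr N t' x₀ x₁ x₂ x₃) = mem (addr N t' x₀ x₁ x₂ x₃)

theorem SameExcept.trans {N t : ℕ} {mem mem' mem'' : ℕ → ℕ} (h : SameExcept N t mem mem')
    (h' : SameExcept N t mem' mem'') : SameExcept N t mem mem'' :=
  ⟨fun a ha => (h'.1 a ha).trans (h.1 a ha), fun t' ht ht' x₀ h₀ x₁ h₁ x₂ h₂ x₃ h₃ =>
    (h'.2 t' ht ht' x₀ h₀ x₁ h₁ x₂ h₂ x₃ h₃).trans (h.2 t' ht ht' x₀ h₀ x₁ h₁ x₂ h₂ x₃ h₃)⟩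

/-- Table `t` represents the relation `P`. -/
def Tab (N : ℕ) (mem : ℕ → ℕ) (t : ℕ) {b₀ b₁ b₂ b₃ : ℕ}
    (P : Fin b₀ → Fin b₁ → Fin b₂ → Fin b₃ → Prop) : Prop :=
  ∀ (x₀ : Fin b₀) (x₁ : Fin b₁) (x₂ : Fin b₂) (x₃ : Fin b₃),
    mem (addr N t x₀ x₁ x₂ x₃) ≠ 0 ↔ P x₀ x₁ x₂ x₃

theorem Tab.congr {N t t' : ℕ} {mem mem' : ℕ → ℕ} {b₀ b₁ b₂ b₃ : ℕ}
    {P : Fin b₀ → Fin b₁ → Fin b₂ → Fin b₃ → Prop} (hP : Tab N mem t' P)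
    (h : SameExcept N t mem mem') (ht : 2 ≤ t') (htt : t' ≠ t) (h₀ : b₀ ≤ N) (h₁ : b₁ ≤ N)
    (h₂ : b₂ ≤ N) (h₃ : b₃ ≤ N) : Tab N mem' t' P := fun x₀ x₁ x₂ x₃ => by
  rw [h.2 t' ht htt _ (x₀.2.trans_le h₀) _ (x₁.2.trans_le h₁) _ (x₂.2.trans_le h₂) _
    (x₃.2.trans_le h₃), hP x₀ x₁ x₂ x₃]

/-! ### Derived expressions -/

namespace Expr

/-- Product of an expression with a variable. -/
def mulVar (e : Expr) (b : ℕ) : Expr := sum 15 b e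

def not (e : Expr) : Expr := sub (const 1) e

def and (a b : Expr) : Expr := not (add (not a) (not b))

def eq (i j : ℕ) : Expr := not (add (sub (var i) (var j)) (sub (var j) (var i)))

theorem eval_not {e : Expr} {ρ mem} : (not e).eval ρ mem = 1 - e.eval ρ mem := rfl

theorem eval_add_ne_zero {a b : Expr} {ρ mem} :
    (add a b).eval ρ mem ≠ 0 ↔ a.eval ρ mem ≠ 0 ∨ b.eval ρ mem ≠ 0 := by
  simp only [eval]
  omega

theorem eval_and_ne_zero {a b : Expr} {ρ mem} :
    (and a b).eval ρ mem ≠ 0 ↔ a.eval ρ mem ≠ 0 ∧ b.eval ρ mem ≠ 0 := by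
  simp only [eval, and, not]
  omega

theorem eval_eq_ne_zero {i j : ℕ} {ρ mem} : (eq i j).eval ρ mem ≠ 0 ↔ ρ i = ρ j := by
  simp only [eval, eq, not]
  omega

theorem eval_sum_ne_zero {v b n : ℕ} {e : Expr} {ρ mem} (hb : ρ b = n) :
    (sum v b e).eval ρ mem ≠ 0 ↔ ∃ x : Fin n, e.eval (Function.update ρ v x) mem ≠ 0 := by
  subst hb
  simp only [eval, ne_eq, Finset.sum_eq_zero_iff, Finset.mem_range, not_forall, Fin.exists_iff,
    exists_prop]

/-- Address of a table entry whose indices are given by variables. -/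
def addr (t v₀ v₁ v₂ v₃ : ℕ) : Expr :=
  add (mulVar (add (mulVar (add (mulVar (add (mulVar (const t) 1) (var v₀)) 1) (var v₁)) 1)
    (var v₂)) 1) (var v₃)

/-- Variable `15` is the dummy of `mulVar` and must not be captured; `v₃` occurs outside all
products and needs no condition. -/
theorem eval_addr {t v₀ v₁ v₂ v₃ N x₀ x₁ x₂ x₃ : ℕ} {ρ mem : ℕ → ℕ} (hN : ρ 1 = N)
    (h₀ : ρ v₀ = x₀) (h₁ : ρ v₁ = x₁) (h₂ : ρ v₂ = x₂) (h₃ : ρ v₃ = x₃)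
    (hv : v₀ ≠ 15 ∧ v₁ ≠ 15 ∧ v₂ ≠ 15 := by decide) :
    (addr t v₀ v₁ v₂ v₃).eval ρ mem = RAM.addr N t x₀ x₁ x₂ x₃ := by
  subst hN h₀ h₁ h₂ h₃
  simp [addr, mulVar, eval, RAM.addr, Function.update_of_ne hv.1, Function.update_of_ne hv.2.1,
    Function.update_of_ne hv.2.2]
  ring

/-- A table entry whose indices are given by variables. -/
def cell (t v₀ v₁ v₂ v₃ : ℕ) : Expr := load (addr t v₀ v₁ v₂ v₃)

theorem eval_cell_ne_zero {t v₀ v₁ v₂ v₃ N : ℕ} {b₀ b₁ b₂ b₃ : ℕ}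
    {P : Fin b₀ → Fin b₁ → Fin b₂ → Fin b₃ → Prop} {ρ mem : ℕ → ℕ} (hP : Tab N mem t P)
    (hN : ρ 1 = N) (x₀ : Fin b₀) (x₁ : Fin b₁) (x₂ : Fin b₂) (x₃ : Fin b₃)
    (h₀ : ρ v₀ = x₀) (h₁ : ρ v₁ = x₁) (h₂ : ρ v₂ = x₂) (h₃ : ρ v₃ = x₃)
    (hv : v₀ ≠ 15 ∧ v₁ ≠ 15 ∧ v₂ ≠ 15 := by decide) :
    (cell t v₀ v₁ v₂ v₃).eval ρ mem ≠ 0 ↔ P x₀ x₁ x₂ x₃ := by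
  rw [← hP x₀ x₁ x₂ x₃, cell, eval, eval_addr hN h₀ h₁ h₂ h₃ hv]

end Expr

/-! ### Assignments to tables -/

namespace Prog

/-- On all memories which differ from `mem` only on `D`, the program `p` changes only cells with
addresses in `X`, and the new contents of those with `ok` addresses are described by `f`. -/
def Fills (D : Set ℕ) (mem : ℕ → ℕ) (ok f : ℕ → Prop) (p : Prog) (ρ : ℕ → ℕ) (X : Set ℕ) : Prop :=
  ∀ mem', (∀ a ∉ D, mem' a = mem a) →
    (∀ a ∈ X, ok a → (p.eval ρ mem' a ≠ 0 ↔ f a)) ∧ ∀ a ∉ X, p.eval ρ mem' a = mem' a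

/-- The sets `X x` may overlap: the last round that writes a cell decides its contents, and `f` is
the same for all rounds. -/
theorem Fills.loop {D : Set ℕ} {mem : ℕ → ℕ} {ok f : ℕ → Prop} {p : Prog} {ρ : ℕ → ℕ} {v b : ℕ}
    {X : ℕ → Set ℕ} (hX : ∀ x < ρ b, X x ⊆ D)
    (h : ∀ x < ρ b, Fills D mem ok f p (Function.update ρ v x) (X x)) :
    Fills D mem ok f (loop v b p) ρ {a | ∃ x < ρ b, a ∈ X x} := by
  have key : ∀ n ≤ ρ b, ∀ mem', (∀ a ∉ D, mem' a = mem a) →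
      (∀ a, (∃ x < n, a ∈ X x) → ok a → ((Nat.rec (motive := fun _ => (ℕ → ℕ) → (ℕ → ℕ)) id
        (fun x f mem => f (p.eval (Function.update ρ v x) mem)) n mem' : ℕ → ℕ) a ≠ 0 ↔ f a)) ∧
      ∀ a, (¬ ∃ x < n, a ∈ X x) → (Nat.rec (motive := fun _ => (ℕ → ℕ) → (ℕ → ℕ)) id
        (fun x f mem => f (p.eval (Function.update ρ v x) mem)) n mem' : ℕ → ℕ) a = mem' a := by
    intro n
    induction n with
    | zero =>
      intro _ mem' _
      exact ⟨fun a ⟨x, hx, _⟩ => absurd hx (Nat.not_lt_zero x), fun _ _ => rfl⟩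
    | succ n ih =>
      intro hn mem' hmem'
      obtain ⟨h₁, h₂⟩ := h n hn mem' hmem'
      obtain ⟨h₃, h₄⟩ := ih (by omega) (p.eval (Function.update ρ v n) mem') fun a ha => by
        rw [h₂ a fun hax => ha (hX n hn hax), hmem' a ha]
      refine ⟨fun a ⟨x, hx, hax⟩ hok => ?_, fun a ha => ?_⟩
      · by_cases hn : ∃ x < n, a ∈ X x
        · exact h₃ a hn hok
        · have : x = n := by
            by_contra hne
            exact hn ⟨x, by omega, hax⟩
          subst this
          change _ ≠ 0 ↔ _
          rw [← h₁ a hax hok]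
          exact iff_of_eq (congrArg (· ≠ 0) (h₄ a hn))
      · exact (h₄ a fun ⟨x, hx, hax⟩ => ha ⟨x, by omega, hax⟩).trans
          (h₂ a fun hax => ha ⟨n, by omega, hax⟩)
  exact fun mem' hmem' => key _ le_rfl mem' hmem'

/-- Fill table `t` with the values of `e`, where the variables `5, …, 8` are the indices. -/
def fill (t : ℕ) (e : Expr) : Prog :=
  loop 5 1 <| loop 6 1 <| loop 7 1 <| loop 8 1 <| store (.addr t 5 6 7 8) e

/-- The assignment of the indices to the variables `5, …, 8`. -/
def index (ρ : ℕ → ℕ) (x₀ x₁ x₂ x₃ : ℕ) : ℕ → ℕ :=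
  Function.update (Function.update (Function.update (Function.update ρ 5 x₀) 6 x₁) 7 x₂) 8 x₃

theorem eval_fill {t N : ℕ} {e : Expr} {ρ mem : ℕ → ℕ} (hN : ρ 1 = N) {b₀ b₁ b₂ b₃ : ℕ}
    {P : Fin b₀ → Fin b₁ → Fin b₂ → Fin b₃ → Prop} (hb₀ : b₀ ≤ N) (hb₁ : b₁ ≤ N) (hb₂ : b₂ ≤ N)
    (hb₃ : b₃ ≤ N)
    (h : ∀ mem', (∀ a ∉ region N t, mem' a = mem a) →
      ∀ (x₀ : Fin b₀) (x₁ : Fin b₁) (x₂ : Fin b₂) (x₃ : Fin b₃),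
      e.eval (index ρ x₀ x₁ x₂ x₃) mem' ≠ 0 ↔ P x₀ x₁ x₂ x₃) :
    Tab N ((fill t e).eval ρ mem) t P ∧
      ∀ a ∉ region N t, (fill t e).eval ρ mem a = mem a := by
  let F : ℕ → ℕ → ℕ → ℕ → Prop := fun x₀ x₁ x₂ x₃ =>
    ∃ (h₀ : x₀ < b₀) (h₁ : x₁ < b₁) (h₂ : x₂ < b₂) (h₃ : x₃ < b₃),
      P ⟨x₀, h₀⟩ ⟨x₁, h₁⟩ ⟨x₂, h₂⟩ ⟨x₃, h₃⟩
  -- The loops run over the full cube of side `N`, but `P` is meaningful only within the bounds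
  -- `b₀`, …, `b₃`; nothing is claimed about the other entries.
  let ok : ℕ → Prop := fun a => a / N / N / N % N < b₀ ∧ a / N / N % N < b₁ ∧ a / N % N < b₂ ∧
    a % N < b₃
  let f : ℕ → Prop := fun a => F (a / N / N / N % N) (a / N / N % N) (a / N % N) (a % N)
  have e₅ : ∀ x₀, (Function.update ρ 5 x₀) 1 = N := fun x₀ => by simp [hN]
  have e₆ : ∀ x₀ x₁, (Function.update (Function.update ρ 5 x₀) 6 x₁) 1 = N :=
    fun x₀ x₁ => by simp [hN]
  have e₇ : ∀ x₀ x₁ x₂, (Function.update (Function.update (Function.update ρ 5 x₀) 6 x₁) 7 x₂) 1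
    = N := fun x₀ x₁ x₂ => by simp [hN]
  have key : Fills (region N t) mem ok f (fill t e) ρ
      {a | ∃ x₀ < ρ 1, ∃ x₁ < (Function.update ρ 5 x₀) 1,
        ∃ x₂ < (Function.update (Function.update ρ 5 x₀) 6 x₁) 1,
        ∃ x₃ < (Function.update (Function.update (Function.update ρ 5 x₀) 6 x₁) 7 x₂) 1,
        a = RAM.addr N t x₀ x₁ x₂ x₃} := by
    refine Fills.loop (X := fun x₀ => {a | ∃ x₁ < (Function.update ρ 5 x₀) 1,
        ∃ x₂ < (Function.update (Function.update ρ 5 x₀) 6 x₁) 1,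
        ∃ x₃ < (Function.update (Function.update (Function.update ρ 5 x₀) 6 x₁) 7 x₂) 1,
        a = RAM.addr N t x₀ x₁ x₂ x₃}) ?_ fun x₀ h₀ => ?_
    · intro x₀ h₀ a ha
      simp only [e₅, e₆, e₇] at ha
      exact ⟨x₀, hN ▸ h₀, ha⟩
    refine Fills.loop (X := fun x₁ => {a |
        ∃ x₂ < (Function.update (Function.update ρ 5 x₀) 6 x₁) 1,
        ∃ x₃ < (Function.update (Function.update (Function.update ρ 5 x₀) 6 x₁) 7 x₂) 1,
        a = RAM.addr N t x₀ x₁ x₂ x₃}) ?_ fun x₁ h₁ => ?_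
    · intro x₁ h₁ a ha
      simp only [e₆, e₇] at ha
      exact ⟨x₀, hN ▸ h₀, x₁, e₅ x₀ ▸ h₁, ha⟩
    refine Fills.loop (X := fun x₂ => {a |
        ∃ x₃ < (Function.update (Function.update (Function.update ρ 5 x₀) 6 x₁) 7 x₂) 1,
        a = RAM.addr N t x₀ x₁ x₂ x₃}) ?_ fun x₂ h₂ => ?_
    · intro x₂ h₂ a ha
      simp only [e₇] at ha
      exact ⟨x₀, hN ▸ h₀, x₁, e₅ x₀ ▸ h₁, x₂, e₆ x₀ x₁ ▸ h₂, ha⟩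
    refine Fills.loop (X := fun x₃ => {a | a = RAM.addr N t x₀ x₁ x₂ x₃}) ?_ fun x₃ h₃ => ?_
    · intro x₃ h₃ a ha
      exact ⟨x₀, hN ▸ h₀, x₁, e₅ x₀ ▸ h₁, x₂, e₆ x₀ x₁ ▸ h₂, x₃, e₇ x₀ x₁ x₂ ▸ h₃, ha⟩
    rw [hN] at h₀
    rw [e₅] at h₁
    rw [e₆] at h₂
    rw [e₇] at h₃
    intro mem' hmem'
    have ha : (Expr.addr t 5 6 7 8).eval (index ρ x₀ x₁ x₂ x₃) mem' = RAM.addr N t x₀ x₁ x₂ x₃ :=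
      Expr.eval_addr (by simp [index, hN]) (by simp [index]) (by simp [index]) (by simp [index])
        (by simp [index])
    refine ⟨?_, fun a hne => ?_⟩
    · rintro _ rfl ⟨k₀, k₁, k₂, k₃⟩
      obtain ⟨d₃, d₂, d₁, d₀, -⟩ := addr_digits (t := t) h₀ h₁ h₂ h₃
      simp only [f, d₀, d₁, d₂, d₃] at k₀ k₁ k₂ k₃ ⊢
      have := h mem' hmem' ⟨x₀, k₀⟩ ⟨x₁, k₁⟩ ⟨x₂, k₂⟩ ⟨x₃, k₃⟩
      simp only [F, k₀, k₁, k₂, k₃, exists_true_left, ← this]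
      exact iff_of_eq (congrArg (· ≠ 0) ((congrArg (Function.update mem' · _ _) ha).trans
        (Function.update_self ..)))
    · exact (congrArg (Function.update mem' · _ _) ha).trans (Function.update_of_ne hne ..)
  obtain ⟨k₁, k₂⟩ := key mem fun _ _ => rfl
  simp only [hN, e₅, e₆, e₇] at k₁ k₂
  refine ⟨fun x₀ x₁ x₂ x₃ => ?_, k₂⟩
  have h₀ := x₀.2.trans_le hb₀
  have h₁ := x₁.2.trans_le hb₁
  have h₂ := x₂.2.trans_le hb₂
  have h₃ := x₃.2.trans_le hb₃
  obtain ⟨d₃, d₂, d₁, d₀, -⟩ := addr_digits (t := t) h₀ h₁ h₂ h₃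
  rw [k₁ _ ⟨_, h₀, _, h₁, _, h₂, _, h₃, rfl⟩ (by simp [ok, d₀, d₁, d₂, d₃])]
  simp [f, F, d₀, d₁, d₂, d₃]

/-- Simultaneous assignment to all entries of table `t`, using table `1` as a temporary. -/
def assign (t : ℕ) (e : Expr) : Prog := seq (fill 1 e) (fill t (.cell 1 5 6 7 8))

/-- In the hypothesis, `SameExcept N 0` exempts no table from number `2` on, so `e` may refer to the
old contents of table `t`; the detour through table `1` makes this sound. -/
theorem eval_assign {t N : ℕ} {e : Expr} {ρ mem : ℕ → ℕ} (hN : ρ 1 = N) (ht : 2 ≤ t)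
    {b₀ b₁ b₂ b₃ : ℕ} {P : Fin b₀ → Fin b₁ → Fin b₂ → Fin b₃ → Prop} (hb₀ : b₀ ≤ N) (hb₁ : b₁ ≤ N)
    (hb₂ : b₂ ≤ N) (hb₃ : b₃ ≤ N)
    (h : ∀ mem', SameExcept N 0 mem mem' →
      ∀ (x₀ : Fin b₀) (x₁ : Fin b₁) (x₂ : Fin b₂) (x₃ : Fin b₃),
      e.eval (index ρ x₀ x₁ x₂ x₃) mem' ≠ 0 ↔ P x₀ x₁ x₂ x₃) :
    SameExcept N t mem ((assign t e).eval ρ mem) ∧ Tab N ((assign t e).eval ρ mem) t P := by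
  obtain ⟨h₁, h₂⟩ := eval_fill (t := 1) hN hb₀ hb₁ hb₂ hb₃ (fun mem' hmem' => h mem'
    ⟨fun a ha => hmem' a (notMem_region_of_lt le_rfl ha), fun t' ht' _ x₀ h₀ x₁ h₁ x₂ h₂ x₃ h₃ =>
      hmem' _ (notMem_region (by omega) h₀ h₁ h₂ h₃)⟩)
  obtain ⟨h₃, h₄⟩ := eval_fill (t := t) (e := .cell 1 5 6 7 8) (mem := (fill 1 e).eval ρ mem) hN
    hb₀ hb₁ hb₂ hb₃ (P := P) (fun mem' hmem' x₀ x₁ x₂ x₃ => by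
      refine Expr.eval_cell_ne_zero (N := N) (fun y₀ y₁ y₂ y₃ => ?_) ?_ x₀ x₁ x₂ x₃ ?_ ?_ ?_ ?_
      · rw [hmem' _ (notMem_region (by omega) (y₀.2.trans_le hb₀) (y₁.2.trans_le hb₁)
          (y₂.2.trans_le hb₂) (y₃.2.trans_le hb₃)), h₁ y₀ y₁ y₂ y₃]
      all_goals simp [index, hN])
  refine ⟨⟨fun a ha => ?_, fun t' ht' htt x₀ h₀ x₁ h₁ x₂ h₂' x₃ h₃ => ?_⟩, h₃⟩
  · exact (h₄ a (notMem_region_of_lt (by omega) ha)).trans (h₂ a (notMem_region_of_lt le_rfl ha))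
  · exact (h₄ _ (notMem_region htt h₀ h₁ h₂' h₃)).trans
      (h₂ _ (notMem_region (by omega) h₀ h₁ h₂' h₃))

end Prog
end RAM

/-! ### The encoding of automata -/

theorem List.getElem?_flatMap_of_length {α β : Type*} {f : α → List β} {k : ℕ} {l : List α}
    (hf : ∀ x ∈ l, (f x).length = k) {i j : ℕ} (hj : j < k) (hi : i < l.length) :
    (l.flatMap f)[i * k + j]? = (f l[i])[j]? := by
  induction l generalizing i with
  | nil => simp at hi
  | cons x l ih =>
    have hx := hf x List.mem_cons_self
    rw [List.flatMap_cons]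
    cases i with
    | zero => rw [List.getElem?_append_left (by omega)]; simp
    | succ i =>
      rw [List.getElem?_append_right (by rw [hx]; nlinarith), hx,
        show (i + 1) * k + j - k = i * k + j by rw [Nat.add_mul]; omega,
        ih (fun y hy => hf y (List.mem_cons_of_mem _ hy)) (by simpa using hi)]
      rfl

theorem List.length_flatMap_of_length {α β : Type*} {f : α → List β} {k : ℕ} {l : List α}
    (hf : ∀ x ∈ l, (f x).length = k) : (l.flatMap f).length = l.length * k := by
  rw [List.length_flatMap, List.map_congr_left hf]
  simp

theorem bit_ne_zero {P : Prop} : bit P ≠ 0 ↔ P := by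
  unfold bit
  split <;> simp_all

namespace NFA

variable {m n : ℕ} (A : NFA (Fin m) (Fin n))

theorem length_encode : A.encode.length = n + n + n * (m * n) := by
  have h₁ : ∀ p, ((List.finRange m).flatMap (fun a =>
      (List.finRange n).map (fun q => bit (q ∈ A.step p a)))).length = m * n := fun p => by
    rw [List.length_flatMap_of_length (k := n) (by simp), List.length_finRange]
  simp only [encode, List.length_append, List.length_map, List.length_finRange]
  rw [List.length_flatMap_of_length (k := m * n) (fun p _ => h₁ p), List.length_finRange]

theorem encode_start (q : Fin n) : A.encode[(q : ℕ)]? = some (bit (q ∈ A.start)) := by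
  unfold encode
  rw [List.append_assoc, List.getElem?_append_left (by simp)]
  simp

theorem encode_accept (q : Fin n) : A.encode[n + q]? = some (bit (q ∈ A.accept)) := by
  unfold encode
  rw [List.getElem?_append_left (by simp), List.getElem?_append_right (by simp)]
  simp

theorem encode_step (p q : Fin n) (a : Fin m) :
    A.encode[n + n + ((p * m + a) * n + q)]? = some (bit (q ∈ A.step p a)) := by
  have h₁ : ∀ p, ((List.finRange m).flatMap (fun a =>
      (List.finRange n).map (fun q => bit (q ∈ A.step p a)))).length = m * n := fun p => by
    rw [List.length_flatMap_of_length (k := n) (by simp), List.length_finRange]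
  have h₂ : a * n + q < m * n := by nlinarith [a.2, q.2]
  unfold encode
  rw [List.getElem?_append_right (by simp)]
  simp only [List.length_append, List.length_map, List.length_finRange]
  rw [show n + n + ((p * m + a) * n + q) - (n + n) = p * (m * n) + (a * n + q) by
    rw [Nat.add_sub_cancel_left]; ring,
    List.getElem?_flatMap_of_length (fun p _ => h₁ p) h₂ (by simp),
    List.getElem?_flatMap_of_length (by simp) q.2 (by simp)]
  simp

/-- The memory contains the tables of an automaton from address `b` on. -/
structure StoredAt {m n : ℕ} (A : NFA (Fin m) (Fin n)) (b : ℕ) (mem : ℕ → ℕ) : Prop where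
  start : ∀ q : Fin n, mem (b + q) ≠ 0 ↔ q ∈ A.start
  accept : ∀ q : Fin n, mem (b + (n + q)) ≠ 0 ↔ q ∈ A.accept
  step : ∀ (p : Fin n) (a : Fin m) (q : Fin n),
    mem (b + (n + n + ((p * m + a) * n + q))) ≠ 0 ↔ q ∈ A.step p a

theorem storedAt_of_getElem? {b : ℕ} {mem : ℕ → ℕ}
    (h : ∀ i < A.encode.length, A.encode[i]? = some (mem (b + i))) : A.StoredAt b mem := by
  have key : ∀ {i : ℕ} {P : Prop}, A.encode[i]? = some (bit P) → (mem (b + i) ≠ 0 ↔ P) := by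
    intro i P hi
    have := h i (List.getElem?_eq_some_iff.1 hi).1
    rw [hi, Option.some_inj] at this
    rw [← this, bit_ne_zero]
  exact ⟨fun q => key (A.encode_start q), fun q => key (A.encode_accept q),
    fun p a q => key (A.encode_step p q a)⟩

end NFA

/-! ### Size of the tables and access to the input automata -/

namespace RAM

/-- Side length of the tables. -/
def side (m n₁ n₂ : ℕ) : ℕ := m + n₁ + n₂ + 3

/-- Hence the working tables do not overwrite the input. The summand `3` in `side` gives `3 * N ^ 3
≤ N ^ 4`: two cubes cover the transition tables, the third all linear terms. -/
theorem length_encodePair_le {m n₁ n₂ : ℕ} (A₁ : NFA (Fin m) (Fin n₁)) (A₂ : NFA (Fin m) (Fin n₂)) :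
    (encodePair A₁ A₂).length ≤ side m n₁ n₂ ^ 4 := by
  simp only [encodePair, List.length_cons, List.length_append, NFA.length_encode]
  have h1 : n₁ ≤ side m n₁ n₂ := by unfold side; omega
  have h2 : n₂ ≤ side m n₁ n₂ := by unfold side; omega
  have hm : m ≤ side m n₁ n₂ := by unfold side; omega
  have h3 : 3 ≤ side m n₁ n₂ := by unfold side; omega
  generalize side m n₁ n₂ = N at *
  have e1 : n₁ * (m * n₁) ≤ N * (N * N) := by gcongr
  have e2 : n₂ * (m * n₂) ≤ N * (N * N) := by gcongr
  have e3 : 3 * (N * (N * N)) ≤ N ^ 4 := by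
    calc 3 * (N * (N * N)) ≤ N * (N * (N * N)) := by gcongr
      _ = N ^ 4 := by ring
  have e4 : 9 * N ≤ N * (N * N) := by
    calc 9 * N = N * (3 * 3) := by ring
      _ ≤ _ := by gcongr
  omega

/-- The variables `0, …, 4` contain `0`, the side length and the parameters of the input. -/
structure Env (m n₁ n₂ : ℕ) (ρ : ℕ → ℕ) : Prop where
  zero : ρ 0 = 0
  side : ρ 1 = side m n₁ n₂
  letters : ρ 2 = m
  states₁ : ρ 3 = n₁
  states₂ : ρ 4 = n₂

theorem Env.update {m n₁ n₂ : ℕ} {ρ : ℕ → ℕ} (h : Env m n₁ n₂ ρ) {v : ℕ} (hv : 5 ≤ v) (x : ℕ) :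
    Env m n₁ n₂ (Function.update ρ v x) := by
  constructor <;> rw [Function.update_of_ne (by omega)]
  exacts [h.zero, h.side, h.letters, h.states₁, h.states₂]

theorem Env.index {m n₁ n₂ : ℕ} {ρ : ℕ → ℕ} (h : Env m n₁ n₂ ρ) (x₀ x₁ x₂ x₃ : ℕ) :
    Env m n₁ n₂ (Prog.index ρ x₀ x₁ x₂ x₃) :=
  (((h.update (by omega) _).update (by omega) _).update (by omega) _).update (by omega) _

namespace Expr

/-- Entry of the table of initial states of an automaton with state number `R k`. -/
def startAt (base : Expr) (q : ℕ) : Expr := load (add base (var q))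

def acceptAt (base : Expr) (k q : ℕ) : Expr := load (add base (add (var k) (var q)))

def stepAt (base : Expr) (k p a q : ℕ) : Expr :=
  load (add base (add (add (var k) (var k))
    (add (mulVar (add (mulVar (var p) 2) (var a)) k) (var q))))

end Expr

/-- The automaton `A` is part of the input `w`, with its tables from the address `base` on and the
number of its states in the variable `k`. -/
structure Input (w : ℕ → ℕ) (m n₁ n₂ : ℕ) {n : ℕ} (A : NFA (Fin m) (Fin n)) (base : Expr) (k : ℕ) :
    Prop where
  reg : ∀ ρ, Env m n₁ n₂ ρ → ρ k = n
  le : n ≤ side m n₁ n₂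
  stored : ∃ b, (∀ ρ mem, Env m n₁ n₂ ρ → base.eval ρ mem = b) ∧
    ∀ mem, (∀ a < side m n₁ n₂ ^ 4, mem a = w a) → A.StoredAt b mem

section Input

variable {w : ℕ → ℕ} {m n₁ n₂ n : ℕ} {A : NFA (Fin m) (Fin n)} {base : Expr} {k : ℕ}

open RAM.Expr

theorem Input.eval_startAt (hA : Input w m n₁ n₂ A base k) {ρ mem : ℕ → ℕ} (hρ : Env m n₁ n₂ ρ)
    (hmem : ∀ a < side m n₁ n₂ ^ 4, mem a = w a) {q : ℕ} {x : Fin n} (hq : ρ q = x) :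
    (startAt base q).eval ρ mem ≠ 0 ↔ x ∈ A.start := by
  obtain ⟨b, hb, hs⟩ := hA.stored
  rw [← (hs mem hmem).start x, startAt]
  simp only [eval, hb ρ mem hρ, hq]

theorem Input.eval_acceptAt (hA : Input w m n₁ n₂ A base k) {ρ mem : ℕ → ℕ} (hρ : Env m n₁ n₂ ρ)
    (hmem : ∀ a < side m n₁ n₂ ^ 4, mem a = w a) {q : ℕ} {x : Fin n} (hq : ρ q = x) :
    (acceptAt base k q).eval ρ mem ≠ 0 ↔ x ∈ A.accept := by
  obtain ⟨b, hb, hs⟩ := hA.stored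
  rw [← (hs mem hmem).accept x, acceptAt]
  simp only [eval, hb ρ mem hρ, hq, hA.reg ρ hρ]

theorem Input.eval_stepAt (hA : Input w m n₁ n₂ A base k) {ρ mem : ℕ → ℕ} (hρ : Env m n₁ n₂ ρ)
    (hmem : ∀ a < side m n₁ n₂ ^ 4, mem a = w a) {p a q : ℕ} {x y : Fin n} {z : Fin m}
    (hp : ρ p = x) (ha : ρ a = z) (hq : ρ q = y)
    (hv : p ≠ 15 ∧ a ≠ 15 := by decide) :
    (stepAt base k p a q).eval ρ mem ≠ 0 ↔ y ∈ A.step x z := by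
  obtain ⟨b, hb, hs⟩ := hA.stored
  rw [← (hs mem hmem).step x z y, stepAt]
  have : (mulVar (add (mulVar (var p) 2) (var a)) k).eval ρ mem = (x * m + z) * n := by
    simp [mulVar, eval, hA.reg ρ hρ, Function.update_of_ne hv.1, Function.update_of_ne hv.2, hp,
      ha, hρ.letters]
    ring
  simp only [eval, hb ρ mem hρ, hq, hA.reg ρ hρ, this]

end Input

/-! ### The algorithm

Table `2` contains alphabets for all pairs of states of the two automata, tables `3` and `4`
contain, for all such pairs, the reachability relation over that alphabet in the first and in the
second automaton, and table `5` contains the pairs reached so far. -/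

namespace Prog

open RAM.Expr

/-- Reachability over the alphabets in table `2` for one automaton. -/
def reach (t : ℕ) (base : Expr) (k : ℕ) : Prog :=
  seq (assign t (eq 7 8)) <| loop 16 1 <| assign t <|
    add (cell t 5 6 7 8) (sum 9 k (sum 10 2
      (and (cell t 5 6 7 9) (and (cell 2 5 6 10 0) (stepAt base k 9 10 8)))))

/-- After `i` rounds, table `t` holds level `i` of `reachLevel` from each `p`; `side m n₁ n₂ ≥ n`
rounds suffice. Variable `16` only counts. -/
theorem eval_reach {w : ℕ → ℕ} {m n₁ n₂ n : ℕ} {A : NFA (Fin m) (Fin n)} {base : Expr} {k t : ℕ}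
    (hA : Input w m n₁ n₂ A base k) (ht : 3 ≤ t) {ρ mem : ℕ → ℕ} (hρ : Env m n₁ n₂ ρ)
    (hmem : ∀ a < side m n₁ n₂ ^ 4, mem a = w a) {L : Fin n₁ → Fin n₂ → Set (Fin m)}
    (hL : Tab (side m n₁ n₂) mem 2 fun c₁ c₂ a (_ : Fin 1) => a ∈ L c₁ c₂) :
    SameExcept (side m n₁ n₂) t mem ((reach t base k).eval ρ mem) ∧
      Tab (side m n₁ n₂) ((reach t base k).eval ρ mem) t fun c₁ c₂ p q =>
        A.HasPathSubset p q (L c₁ c₂) := by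
  have hn₁ : n₁ ≤ side m n₁ n₂ := by unfold side; omega
  have hn₂ : n₂ ≤ side m n₁ n₂ := by unfold side; omega
  have hm : m ≤ side m n₁ n₂ := by unfold side; omega
  have h1 : 1 ≤ side m n₁ n₂ := by unfold side; omega
  have hn := hA.le
  let E : Fin n₁ → Fin n₂ → Fin n → Fin n → Prop := fun c₁ c₂ p q =>
    ∃ a ∈ L c₁ c₂, q ∈ A.step p a
  have key := eval_loop_induction (v := 16) (b := 1) (ρ := ρ) (k := 0)
    (p := assign t <| add (cell t 5 6 7 8) (sum 9 k (sum 10 2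
      (and (cell t 5 6 7 9) (and (cell 2 5 6 10 0) (stepAt base k 9 10 8))))))
    (mem := (assign t (eq 7 8)).eval ρ mem)
    (I := fun k mem' => SameExcept (side m n₁ n₂) t mem mem' ∧
      Tab (side m n₁ n₂) mem' t fun c₁ c₂ p q => q ∈ reachLevel (E c₁ c₂) {p} k) ?_ ?_
  · refine ⟨key.1, fun c₁ c₂ p q => (key.2 c₁ c₂ p q).trans ?_⟩
    change q ∈ reachLevel (E c₁ c₂) {p} (0 + ρ 1) ↔ A.HasPathSubset p q (L c₁ c₂)
    rw [mem_reachLevel_iff (by rw [Nat.card_fin, hρ.side]; omega), NFA.hasPathSubset_iff]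
    simp [E]
  · refine eval_assign hρ.side (by omega) hn₁ hn₂ hn hn fun mem' _ c₁ c₂ p q => ?_
    rw [eval_eq_ne_zero, mem_reachLevel_zero, Set.mem_singleton_iff, ← Fin.val_inj]
    simp [index, eq_comm]
  · rintro i mem₁ x hx ⟨hsame, htab⟩
    have hρ' := hρ.update (v := 16) (by omega) x
    obtain ⟨h₁, h₂⟩ := eval_assign (t := t) (e := add (cell t 5 6 7 8) (sum 9 k (sum 10 2
      (and (cell t 5 6 7 9) (and (cell 2 5 6 10 0) (stepAt base k 9 10 8))))))
      (ρ := Function.update ρ 16 x) (mem := mem₁)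
      (P := fun (c₁ : Fin n₁) (c₂ : Fin n₂) (p : Fin n) (q : Fin n) =>
        q ∈ reachLevel (E c₁ c₂) {p} (i + 1)) hρ'.side (by omega) hn₁ hn₂ hn hn (by
        intro mem₂ hmem₂ c₁ c₂ p q
        have hρ₁ := hρ'.index c₁ c₂ p q
        have t₂ := htab.congr hmem₂ (by omega) (by omega) hn₁ hn₂ hn hn
        have l₂ := (hL.congr hsame (by omega) (by omega) hn₁ hn₂ hm h1).congr hmem₂ (by omega)
          (by omega) hn₁ hn₂ hm h1
        have w₂ : ∀ a < side m n₁ n₂ ^ 4, mem₂ a = w a := fun a ha => by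
          rw [hmem₂.1 a ha, hsame.1 a ha, hmem a ha]
        rw [eval_add_ne_zero, mem_reachLevel_succ,
          eval_cell_ne_zero t₂ hρ₁.side c₁ c₂ p q (by simp [index]) (by simp [index])
            (by simp [index]) (by simp [index])]
        refine or_congr Iff.rfl ?_
        rw [eval_sum_ne_zero (hA.reg _ hρ₁)]
        refine exists_congr fun r => ?_
        have hρ₂ := hρ₁.update (v := 9) (by omega) r
        rw [eval_sum_ne_zero hρ₂.letters, ← exists_and_left]
        refine exists_congr fun a => ?_
        have hρ₃ := hρ₂.update (v := 10) (by omega) a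
        rw [eval_and_ne_zero, eval_and_ne_zero,
          eval_cell_ne_zero t₂ hρ₃.side c₁ c₂ p r (by simp [index]) (by simp [index])
            (by simp [index]) (by simp [index]),
          eval_cell_ne_zero l₂ hρ₃.side c₁ c₂ a 0 (by simp [index]) (by simp [index])
            (by simp [index]) hρ₃.zero,
          hA.eval_stepAt hρ₃ w₂ (x := r) (y := q) (z := a) (by simp [index]) (by simp [index])
            (by simp [index])])
    exact ⟨hsame.trans h₁, h₂⟩

end Prog
end RAM

namespace RAM
namespace Prog

open RAM.Expr

/-- The letter in the variable `7` is on a loop around the state in the variable `c` over the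
alphabet for which table `t` contains the reachability relation. -/
def onLoop (t : ℕ) (base : Expr) (k c : ℕ) : Expr :=
  sum 9 k (sum 10 k
    (and (cell t 5 6 c 9) (and (stepAt base k 9 7 10) (cell t 5 6 10 c))))

theorem eval_onLoop {w : ℕ → ℕ} {m n₁ n₂ n : ℕ} {A : NFA (Fin m) (Fin n)} {base : Expr} {k t c : ℕ}
    (hA : Input w m n₁ n₂ A base k) {ρ mem : ℕ → ℕ} (hρ : Env m n₁ n₂ ρ)
    (hmem : ∀ a < side m n₁ n₂ ^ 4, mem a = w a) {L : Fin n₁ → Fin n₂ → Set (Fin m)}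
    (hR : Tab (side m n₁ n₂) mem t fun c₁ c₂ p q => A.HasPathSubset p q (L c₁ c₂))
    {c₁ : Fin n₁} {c₂ : Fin n₂} {a : Fin m} {x : Fin n} (h₁ : ρ 5 = c₁) (h₂ : ρ 6 = c₂)
    (ha : ρ 7 = a) (hc : ρ c = x) (hc9 : c < 9) :
    (onLoop t base k c).eval ρ mem ≠ 0 ↔ a ∈ A.loopLetters x (L c₁ c₂) := by
  unfold onLoop NFA.loopLetters
  rw [eval_sum_ne_zero (hA.reg _ hρ)]
  refine exists_congr fun p => ?_
  have hρ₁ := hρ.update (v := 9) (by omega) p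
  rw [eval_sum_ne_zero (hA.reg _ hρ₁)]
  refine exists_congr fun q => ?_
  have hρ₂ := hρ₁.update (v := 10) (by omega) q
  have hc' : (Function.update (Function.update ρ 9 (p : ℕ)) 10 (q : ℕ)) c = x := by
    rw [Function.update_of_ne (by omega), Function.update_of_ne (by omega), hc]
  rw [eval_and_ne_zero, eval_and_ne_zero,
    eval_cell_ne_zero hR hρ₂.side c₁ c₂ x p (by simp [h₁]) (by simp [h₂]) hc' (by simp)
      ⟨by omega, by omega, by omega⟩,
    eval_cell_ne_zero hR hρ₂.side c₁ c₂ q x (by simp [h₁]) (by simp [h₂]) (by simp) hc',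
    hA.eval_stepAt hρ₂ hmem (x := p) (y := q) (z := a) (by simp) (by simp [ha]) (by simp)]

/-- Reachability over the alphabets in table `2` for both automata. -/
def reachBoth (base₁ base₂ : Expr) : Prog := seq (reach 3 base₁ 3) (reach 4 base₂ 4)

/-- Compute the greatest alphabets of common loops. -/
def letters (base₁ base₂ : Expr) : Prog :=
  seq (assign 2 (const 1)) <| loop 17 1 <| seq (reachBoth base₁ base₂) <| assign 2 <|
    and (cell 2 5 6 7 0) (and (onLoop 3 base₁ 3 5) (onLoop 4 base₂ 4 6))

/-- The initial pairs of states. -/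
def startPairs (base₁ base₂ : Expr) : Prog := assign 5 (and (startAt base₁ 5) (startAt base₂ 6))

/-- The pairs of states reachable in one more step. -/
def stepPairs (base₁ base₂ : Expr) : Prog :=
  assign 5 <| add (cell 5 5 6 0 0) <| sum 9 3 <| sum 10 4 <| and (cell 5 9 10 0 0) <|
    add (sum 11 2 (and (stepAt base₁ 3 9 11 5) (stepAt base₂ 4 10 11 6)))
      (sum 11 3 (sum 12 4 (and (and (cell 3 11 12 9 11) (cell 3 11 12 11 5))
        (and (cell 4 11 12 10 12) (cell 4 11 12 12 6)))))

/-- The reachable pairs of states. -/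
def pairs (base₁ base₂ : Expr) : Prog :=
  seq (startPairs base₁ base₂) (loop 17 1 (loop 16 1 (stepPairs base₁ base₂)))

/-- The whole computation up to the final test. -/
def main (base₁ base₂ : Expr) : Prog :=
  seq (letters base₁ base₂) (seq (reachBoth base₁ base₂) (pairs base₁ base₂))

/-- There is a reachable pair of final states. -/
def result (base₁ base₂ : Expr) : Expr :=
  sum 5 3 (sum 6 4 (and (cell 5 5 6 0 0) (and (acceptAt base₁ 3 5) (acceptAt base₂ 4 6))))

/-! ### Correctness of the algorithm -/

section

variable {w : ℕ → ℕ} {m n₁ n₂ : ℕ} {A₁ : NFA (Fin m) (Fin n₁)} {A₂ : NFA (Fin m) (Fin n₂)}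
  {base₁ base₂ : Expr} {ρ mem : ℕ → ℕ}

theorem le_side (m n₁ n₂ : ℕ) :
    m ≤ side m n₁ n₂ ∧ n₁ ≤ side m n₁ n₂ ∧ n₂ ≤ side m n₁ n₂ ∧ 1 ≤ side m n₁ n₂ := by
  unfold side; omega

theorem eval_reachBoth (hA₁ : Input w m n₁ n₂ A₁ base₁ 3) (hA₂ : Input w m n₁ n₂ A₂ base₂ 4)
    (hρ : Env m n₁ n₂ ρ) (hmem : ∀ a < side m n₁ n₂ ^ 4, mem a = w a)
    {L : Fin n₁ → Fin n₂ → Set (Fin m)}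
    (hL : Tab (side m n₁ n₂) mem 2 fun c₁ c₂ a (_ : Fin 1) => a ∈ L c₁ c₂) :
    (∀ a < side m n₁ n₂ ^ 4, (reachBoth base₁ base₂).eval ρ mem a = w a) ∧
    (Tab (side m n₁ n₂) ((reachBoth base₁ base₂).eval ρ mem) 2
      fun c₁ c₂ a (_ : Fin 1) => a ∈ L c₁ c₂) ∧
    (Tab (side m n₁ n₂) ((reachBoth base₁ base₂).eval ρ mem) 3 fun c₁ c₂ p q =>
      A₁.HasPathSubset p q (L c₁ c₂)) ∧
    Tab (side m n₁ n₂) ((reachBoth base₁ base₂).eval ρ mem) 4 fun c₁ c₂ p q =>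
      A₂.HasPathSubset p q (L c₁ c₂) := by
  obtain ⟨hm, hn₁, hn₂, h1⟩ := le_side m n₁ n₂
  obtain ⟨s₁, r₁⟩ := eval_reach hA₁ (t := 3) (by omega) hρ hmem hL
  have hL' := hL.congr s₁ (by omega) (by omega) hn₁ hn₂ hm h1
  have hmem' : ∀ a < side m n₁ n₂ ^ 4, (reach 3 base₁ 3).eval ρ mem a = w a := fun a ha => by
    rw [s₁.1 a ha, hmem a ha]
  obtain ⟨s₂, r₂⟩ := eval_reach hA₂ (t := 4) (by omega) hρ hmem' hL'
  exact ⟨fun a ha => (s₂.1 a ha).trans (hmem' a ha),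
    hL'.congr s₂ (by omega) (by omega) hn₁ hn₂ hm h1,
    r₁.congr s₂ (by omega) (by omega) hn₁ hn₂ hn₁ hn₁, r₂⟩

theorem eval_letters (hA₁ : Input w m n₁ n₂ A₁ base₁ 3) (hA₂ : Input w m n₁ n₂ A₂ base₂ 4)
    (hρ : Env m n₁ n₂ ρ) (hmem : ∀ a < side m n₁ n₂ ^ 4, mem a = w a) :
    (∀ a < side m n₁ n₂ ^ 4, (letters base₁ base₂).eval ρ mem a = w a) ∧
    Tab (side m n₁ n₂) ((letters base₁ base₂).eval ρ mem) 2
      fun c₁ c₂ a (_ : Fin 1) => a ∈ letterLevel A₁ A₂ c₁ c₂ (side m n₁ n₂) := by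
  obtain ⟨hm, hn₁, hn₂, h1⟩ := le_side m n₁ n₂
  -- Exhibits the number of rounds in the form `0 + ρ 1` in which the invariant rule concludes.
  rw [← zero_add (side m n₁ n₂), ← hρ.side]
  refine eval_loop_induction (v := 17) (b := 1) (k := 0) (I := fun k mem' =>
    (∀ a < (0 + ρ 1) ^ 4, mem' a = w a) ∧ Tab (0 + ρ 1) mem' 2
      fun c₁ c₂ a (_ : Fin 1) => a ∈ letterLevel A₁ A₂ c₁ c₂ k) ?_ ?_
  · obtain ⟨s, t⟩ := eval_assign (t := 2) (e := const 1) (mem := mem) (ρ := ρ)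
      (P := fun c₁ c₂ a (_ : Fin 1) => a ∈ letterLevel A₁ A₂ c₁ c₂ 0) hρ.side le_rfl hn₁ hn₂ hm h1
      (fun mem' _ c₁ c₂ a _ => by simp [Expr.eval, letterLevel])
    rw [hρ.side, zero_add]
    exact ⟨fun a ha => (s.1 a ha).trans (hmem a ha), t⟩
  · rw [hρ.side, zero_add]
    rintro i mem₁ x - ⟨w₁, hL⟩
    have hρ' := hρ.update (v := 17) (by omega) x
    obtain ⟨w₂, l₂, r₂, r₂'⟩ := eval_reachBoth hA₁ hA₂ hρ' w₁ hL
    obtain ⟨s, t⟩ := eval_assign (t := 2) (mem := (reachBoth base₁ base₂).eval _ mem₁)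
      (ρ := Function.update ρ 17 x)
      (e := and (cell 2 5 6 7 0) (and (onLoop 3 base₁ 3 5) (onLoop 4 base₂ 4 6)))
      (P := fun c₁ c₂ a (_ : Fin 1) => a ∈ letterLevel A₁ A₂ c₁ c₂ (i + 1)) hρ'.side le_rfl
      hn₁ hn₂ hm h1
      (fun mem₃ hmem₃ c₁ c₂ a y => by
        have hρ₁ := hρ'.index c₁ c₂ a y
        have w₃ : ∀ a < side m n₁ n₂ ^ 4, mem₃ a = w a := fun a ha => by
          rw [hmem₃.1 a ha, w₂ a ha]
        rw [mem_letterLevel_succ, eval_and_ne_zero, eval_and_ne_zero,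
          eval_cell_ne_zero (l₂.congr hmem₃ (by omega) (by omega) hn₁ hn₂ hm h1) hρ₁.side
            c₁ c₂ a 0 (by simp [index]) (by simp [index]) (by simp [index]) hρ₁.zero,
          eval_onLoop hA₁ hρ₁ w₃ (r₂.congr hmem₃ (by omega) (by omega) hn₁ hn₂ hn₁ hn₁)
            (c₁ := c₁) (c₂ := c₂) (a := a) (x := c₁) (by simp [index]) (by simp [index])
            (by simp [index]) (by simp [index]) (by omega),
          eval_onLoop hA₂ hρ₁ w₃ (r₂'.congr hmem₃ (by omega) (by omega) hn₁ hn₂ hn₂ hn₂)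
            (c₁ := c₁) (c₂ := c₂) (a := a) (x := c₂) (by simp [index]) (by simp [index])
            (by simp [index]) (by simp [index]) (by omega)])
    exact ⟨fun a ha => (s.1 a ha).trans (w₂ a ha), t⟩

/-- The memory contains the input, the reachability relations for the alphabets `L`, and the set
`S` of pairs. -/
structure PairState (w : ℕ → ℕ) (A₁ : NFA (Fin m) (Fin n₁)) (A₂ : NFA (Fin m) (Fin n₂))
    (L : Fin n₁ → Fin n₂ → Set (Fin m)) (S : Set (Fin n₁ × Fin n₂)) (mem : ℕ → ℕ) : Prop where
  input : ∀ a < side m n₁ n₂ ^ 4, mem a = w a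
  reach₁ : Tab (side m n₁ n₂) mem 3 fun c₁ c₂ p q => A₁.HasPathSubset p q (L c₁ c₂)
  reach₂ : Tab (side m n₁ n₂) mem 4 fun c₁ c₂ p q => A₂.HasPathSubset p q (L c₁ c₂)
  pairs : Tab (side m n₁ n₂) mem 5 fun p₁ p₂ (_ _ : Fin 1) => (p₁, p₂) ∈ S

theorem eval_startPairs (hA₁ : Input w m n₁ n₂ A₁ base₁ 3) (hA₂ : Input w m n₁ n₂ A₂ base₂ 4)
    (hρ : Env m n₁ n₂ ρ) (hmem : ∀ a < side m n₁ n₂ ^ 4, mem a = w a)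
    {L : Fin n₁ → Fin n₂ → Set (Fin m)}
    (hR₁ : Tab (side m n₁ n₂) mem 3 fun c₁ c₂ p q => A₁.HasPathSubset p q (L c₁ c₂))
    (hR₂ : Tab (side m n₁ n₂) mem 4 fun c₁ c₂ p q => A₂.HasPathSubset p q (L c₁ c₂)) :
    PairState w A₁ A₂ L {x | x.1 ∈ A₁.start ∧ x.2 ∈ A₂.start}
      ((startPairs base₁ base₂).eval ρ mem) := by
  obtain ⟨hm, hn₁, hn₂, h1⟩ := le_side m n₁ n₂
  obtain ⟨s, t⟩ := eval_assign (t := 5) (mem := mem) (ρ := ρ)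
    (e := and (startAt base₁ 5) (startAt base₂ 6))
    (P := fun p₁ p₂ (_ _ : Fin 1) => p₁ ∈ A₁.start ∧ p₂ ∈ A₂.start) hρ.side (by omega)
    hn₁ hn₂ h1 h1 (fun mem' hmem' p₁ p₂ x y => by
      have hρ₁ := hρ.index p₁ p₂ x y
      have w₁ : ∀ a < side m n₁ n₂ ^ 4, mem' a = w a := fun a ha => by
        rw [hmem'.1 a ha, hmem a ha]
      rw [eval_and_ne_zero, hA₁.eval_startAt hρ₁ w₁ (x := p₁) (by simp [index]),
        hA₂.eval_startAt hρ₁ w₁ (x := p₂) (by simp [index])])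
  exact ⟨fun a ha => (s.1 a ha).trans (hmem a ha),
    hR₁.congr s (by omega) (by omega) hn₁ hn₂ hn₁ hn₁,
    hR₂.congr s (by omega) (by omega) hn₁ hn₂ hn₂ hn₂, t⟩

theorem eval_stepPairs (hA₁ : Input w m n₁ n₂ A₁ base₁ 3) (hA₂ : Input w m n₁ n₂ A₂ base₂ 4)
    (hρ : Env m n₁ n₂ ρ) {L : Fin n₁ → Fin n₂ → Set (Fin m)} {S : Set (Fin n₁ × Fin n₂)}
    (h : PairState w A₁ A₂ L S mem) :
    PairState w A₁ A₂ L {y | y ∈ S ∨ ∃ x ∈ S, PairStep A₁ A₂ L x y}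
      ((stepPairs base₁ base₂).eval ρ mem) := by
  obtain ⟨hm, hn₁, hn₂, h1⟩ := le_side m n₁ n₂
  obtain ⟨s, t⟩ := eval_assign (t := 5) (mem := mem) (ρ := ρ)
    (e := add (cell 5 5 6 0 0) <| sum 9 3 <| sum 10 4 <| and (cell 5 9 10 0 0) <|
      add (sum 11 2 (and (stepAt base₁ 3 9 11 5) (stepAt base₂ 4 10 11 6)))
        (sum 11 3 (sum 12 4 (and (and (cell 3 11 12 9 11) (cell 3 11 12 11 5))
          (and (cell 4 11 12 10 12) (cell 4 11 12 12 6))))))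
    (P := fun q₁ q₂ (_ _ : Fin 1) =>
      (q₁, q₂) ∈ {y | y ∈ S ∨ ∃ x ∈ S, PairStep A₁ A₂ L x y}) hρ.side (by omega)
    hn₁ hn₂ h1 h1 (fun mem' hmem' q₁ q₂ x y => by
      have hρ₁ := hρ.index q₁ q₂ x y
      have w₁ : ∀ a < side m n₁ n₂ ^ 4, mem' a = w a := fun a ha => by
        rw [hmem'.1 a ha, h.input a ha]
      have t₃ := h.reach₁.congr hmem' (by omega) (by omega) hn₁ hn₂ hn₁ hn₁
      have t₄ := h.reach₂.congr hmem' (by omega) (by omega) hn₁ hn₂ hn₂ hn₂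
      have t₅ := h.pairs.congr hmem' (by omega) (by omega) hn₁ hn₂ h1 h1
      rw [eval_add_ne_zero, eval_cell_ne_zero t₅ hρ₁.side q₁ q₂ 0 0 (by simp [index])
        (by simp [index]) hρ₁.zero hρ₁.zero]
      refine or_congr Iff.rfl ?_
      rw [eval_sum_ne_zero hρ₁.states₁, Prod.exists]
      refine exists_congr fun p₁ => ?_
      have hρ₂ := hρ₁.update (v := 9) (by omega) p₁
      rw [eval_sum_ne_zero hρ₂.states₂]
      refine exists_congr fun p₂ => ?_
      have hρ₃ := hρ₂.update (v := 10) (by omega) p₂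
      rw [eval_and_ne_zero, eval_cell_ne_zero t₅ hρ₃.side p₁ p₂ 0 0 (by simp [index])
        (by simp [index]) hρ₃.zero hρ₃.zero]
      refine and_congr Iff.rfl ?_
      rw [eval_add_ne_zero]
      refine or_congr ?_ ?_
      · rw [eval_sum_ne_zero hρ₃.letters]
        refine exists_congr fun a => ?_
        have hρ₄ := hρ₃.update (v := 11) (by omega) a
        rw [eval_and_ne_zero,
          hA₁.eval_stepAt hρ₄ w₁ (x := p₁) (y := q₁) (z := a) (by simp [index]) (by simp [index])
            (by simp [index]),
          hA₂.eval_stepAt hρ₄ w₁ (x := p₂) (y := q₂) (z := a) (by simp [index]) (by simp [index])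
            (by simp [index])]
      · rw [eval_sum_ne_zero hρ₃.states₁]
        refine exists_congr fun c₁ => ?_
        have hρ₄ := hρ₃.update (v := 11) (by omega) c₁
        rw [eval_sum_ne_zero hρ₄.states₂]
        refine exists_congr fun c₂ => ?_
        have hρ₅ := hρ₄.update (v := 12) (by omega) c₂
        rw [eval_and_ne_zero, eval_and_ne_zero, eval_and_ne_zero,
          eval_cell_ne_zero t₃ hρ₅.side c₁ c₂ p₁ c₁ (by simp [index]) (by simp [index])
            (by simp [index]) (by simp [index]),
          eval_cell_ne_zero t₃ hρ₅.side c₁ c₂ c₁ q₁ (by simp [index]) (by simp [index])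
            (by simp [index]) (by simp [index]),
          eval_cell_ne_zero t₄ hρ₅.side c₁ c₂ p₂ c₂ (by simp [index]) (by simp [index])
            (by simp [index]) (by simp [index]),
          eval_cell_ne_zero t₄ hρ₅.side c₁ c₂ c₂ q₂ (by simp [index]) (by simp [index])
            (by simp [index]) (by simp [index])])
  exact ⟨fun a ha => (s.1 a ha).trans (h.input a ha),
    h.reach₁.congr s (by omega) (by omega) hn₁ hn₂ hn₁ hn₁,
    h.reach₂.congr s (by omega) (by omega) hn₁ hn₂ hn₂ hn₂, t⟩

/-- There are up to `n₁ * n₂` pairs, and a loop bound has to be a variable, so the required number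
of rounds comes from two nested loops; the outer invariant sits at the multiples of `side m n₁ n₂`.
-/
theorem eval_main (hA₁ : Input w m n₁ n₂ A₁ base₁ 3) (hA₂ : Input w m n₁ n₂ A₂ base₂ 4)
    (hρ : Env m n₁ n₂ ρ) (hmem : ∀ a < side m n₁ n₂ ^ 4, mem a = w a) :
    PairState w A₁ A₂ (fun c₁ c₂ => letterLevel A₁ A₂ c₁ c₂ (side m n₁ n₂))
      (reachLevel (PairStep A₁ A₂ fun c₁ c₂ => letterLevel A₁ A₂ c₁ c₂ (side m n₁ n₂))
        {x | x.1 ∈ A₁.start ∧ x.2 ∈ A₂.start} (side m n₁ n₂ * side m n₁ n₂))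
      ((main base₁ base₂).eval ρ mem) := by
  obtain ⟨w₁, l₁⟩ := eval_letters hA₁ hA₂ hρ hmem
  -- `letters` ends by refining the alphabets, so reachability is recomputed for the final ones.
  obtain ⟨w₂, -, r₂, r₂'⟩ := eval_reachBoth hA₁ hA₂ hρ w₁ l₁
  have hS := eval_startPairs hA₁ hA₂ hρ w₂ r₂ r₂'
  have key := eval_loop_induction (v := 17) (b := 1) (ρ := ρ) (k := 0)
    (p := loop 16 1 (stepPairs base₁ base₂)) (I := fun k mem' =>
      PairState w A₁ A₂ (fun c₁ c₂ => letterLevel A₁ A₂ c₁ c₂ (side m n₁ n₂))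
      (reachLevel (PairStep A₁ A₂ fun c₁ c₂ => letterLevel A₁ A₂ c₁ c₂ (side m n₁ n₂))
        {x | x.1 ∈ A₁.start ∧ x.2 ∈ A₂.start} (k * side m n₁ n₂)) mem')
    (by rw [zero_mul]; exact hS) (fun i mem₁ x _ h₁ => by
      have hρ' := hρ.update (v := 17) (by omega) x
      have := eval_loop_induction (v := 16) (b := 1) (ρ := Function.update ρ 17 x)
        (k := i * side m n₁ n₂)
        (p := stepPairs base₁ base₂) (I := fun k mem' =>
          PairState w A₁ A₂ (fun c₁ c₂ => letterLevel A₁ A₂ c₁ c₂ (side m n₁ n₂))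
          (reachLevel (PairStep A₁ A₂ fun c₁ c₂ => letterLevel A₁ A₂ c₁ c₂ (side m n₁ n₂))
            {x | x.1 ∈ A₁.start ∧ x.2 ∈ A₂.start} k) mem') h₁ (fun j mem₂ y _ h₂ => by
          rw [show reachLevel (PairStep A₁ A₂ fun c₁ c₂ =>
            letterLevel A₁ A₂ c₁ c₂ (side m n₁ n₂)) {x | x.1 ∈ A₁.start ∧ x.2 ∈ A₂.start} (j + 1)
            = {y | _ ∨ _} from Set.ext fun _ => mem_reachLevel_succ]
          exact eval_stepPairs hA₁ hA₂ (hρ'.update (by omega) y) h₂)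
      rwa [hρ'.side, ← Nat.succ_mul] at this)
  rwa [hρ.side, zero_add] at key

theorem eval_result (hA₁ : Input w m n₁ n₂ A₁ base₁ 3) (hA₂ : Input w m n₁ n₂ A₂ base₂ 4)
    (hρ : Env m n₁ n₂ ρ) (hmem : ∀ a < side m n₁ n₂ ^ 4, mem a = w a) :
    (result base₁ base₂).eval ρ ((main base₁ base₂).eval ρ mem) ≠ 0 ↔
      ∃ π, IsNonPTSepWitness A₁ A₂ π := by
  have h := eval_main hA₁ hA₂ hρ hmem
  obtain ⟨hm, hn₁, hn₂, h1⟩ := le_side m n₁ n₂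
  rw [exists_isNonPTSepWitness_iff (k := side m n₁ n₂) (n := side m n₁ n₂ * side m n₁ n₂)
    (by rwa [Nat.card_fin])
    (by rw [Nat.card_prod, Nat.card_fin, Nat.card_fin]; exact Nat.mul_le_mul hn₁ hn₂)]
  rw [result, eval_sum_ne_zero hρ.states₁, Prod.exists]
  refine exists_congr fun q₁ => ?_
  have hρ₁ := hρ.update (v := 5) (by omega) q₁
  rw [eval_sum_ne_zero hρ₁.states₂]
  refine exists_congr fun q₂ => ?_
  have hρ₂ := hρ₁.update (v := 6) (by omega) q₂
  rw [eval_and_ne_zero, eval_and_ne_zero,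
    eval_cell_ne_zero h.pairs hρ₂.side q₁ q₂ 0 0 (by simp) (by simp) hρ₂.zero hρ₂.zero,
    hA₁.eval_acceptAt hρ₂ h.input (x := q₁) (by simp),
    hA₂.eval_acceptAt hρ₂ h.input (x := q₂) (by simp)]

end

end Prog

/-! ### The input of the machine -/

section Machine

open RAM.Expr

/-- Address of the tables of the first automaton. -/
def base₁ : Expr := const 3

/-- Address of the tables of the second automaton. -/
def base₂ : Expr :=
  add (const 3) (add (add (var 3) (var 3)) (mulVar (mulVar (var 3) 2) 3))

theorem encodePair_getElem? {m n₁ n₂ : ℕ} (A₁ : NFA (Fin m) (Fin n₁)) (A₂ : NFA (Fin m) (Fin n₂))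
    (i : ℕ) : (encodePair A₁ A₂)[3 + i]? = (A₁.encode ++ A₂.encode)[i]? := by
  rw [add_comm]
  rfl

theorem input₁ {m n₁ n₂ : ℕ} (A₁ : NFA (Fin m) (Fin n₁)) (A₂ : NFA (Fin m) (Fin n₂)) :
    Input (fun i => (encodePair A₁ A₂).getD i 0) m n₁ n₂ A₁ base₁ 3 where
  reg _ h := h.states₁
  le := by unfold side; omega
  stored := by
    refine ⟨3, fun _ _ _ => rfl, fun mem hmem => A₁.storedAt_of_getElem? fun i hi => ?_⟩
    have h := encodePair_getElem? A₁ A₂ i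
    rw [List.getElem?_append_left hi] at h
    have hlt : 3 + i < (encodePair A₁ A₂).length := by
      by_contra hge
      rw [List.getElem?_eq_none (not_lt.1 hge), List.getElem?_eq_getElem hi] at h
      simp at h
    rw [hmem _ (hlt.trans_le (length_encodePair_le A₁ A₂)), List.getD_eq_getElem?_getD, h,
      List.getElem?_eq_getElem hi, Option.getD_some]

theorem input₂ {m n₁ n₂ : ℕ} (A₁ : NFA (Fin m) (Fin n₁)) (A₂ : NFA (Fin m) (Fin n₂)) :
    Input (fun i => (encodePair A₁ A₂).getD i 0) m n₁ n₂ A₂ base₂ 4 where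
  reg _ h := h.states₂
  le := by unfold side; omega
  stored := by
    refine ⟨3 + A₁.encode.length, fun ρ mem hρ => ?_, fun mem hmem =>
      A₂.storedAt_of_getElem? fun i hi => ?_⟩
    · simp [base₂, mulVar, eval, hρ.states₁, hρ.letters, NFA.length_encode]
    have h := encodePair_getElem? A₁ A₂ (A₁.encode.length + i)
    rw [List.getElem?_append_right (by omega), Nat.add_sub_cancel_left, ← add_assoc] at h
    have hlt : 3 + A₁.encode.length + i < (encodePair A₁ A₂).length := by
      by_contra hge
      rw [List.getElem?_eq_none (not_lt.1 hge), List.getElem?_eq_getElem hi] at h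
      simp at h
    rw [hmem _ (hlt.trans_le (length_encodePair_le A₁ A₂)), List.getD_eq_getElem?_getD, h,
      List.getElem?_eq_getElem hi, Option.getD_some]

/-- Load the parameters of the input, and compute the side length. -/
def prelude : Cmd :=
  .seq (.ins (.load 2 0)) <| .seq (.ins (.const 1 1)) <| .seq (.ins (.load 3 1)) <|
    .seq (.ins (.const 1 2)) <| .seq (.ins (.load 4 1)) <| .seq (.ins (.const 1 3)) <|
      .seq (.ins (.add 1 1 2)) <| .seq (.ins (.add 1 1 3)) (.ins (.add 1 1 4))

theorem runs_prelude {m n₁ n₂ : ℕ} {mem : ℕ → ℕ} (h₀ : mem 0 = m) (h₁ : mem 1 = n₁)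
    (h₂ : mem 2 = n₂) : ∃ reg, Cmd.Runs prelude (fun _ => 0) mem reg mem 9 ∧ Env m n₁ n₂ reg ∧
      ∀ r, reg r ≤ side m n₁ n₂ := by
  refine ⟨_, .seq (Cmd.runs_load ..) (.seq (Cmd.runs_const ..) (.seq (Cmd.runs_load ..)
    (.seq (Cmd.runs_const ..) (.seq (Cmd.runs_load ..) (.seq (Cmd.runs_const ..)
      (.seq (Cmd.runs_add ..) (.seq (Cmd.runs_add ..) (Cmd.runs_add ..)))))))), ?_, ?_⟩
  · constructor <;> simp [h₀, h₁, h₂, side]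
    ring
  · intro r
    simp only [Function.update_apply, side]
    simp [h₀, h₁, h₂]
    split_ifs <;> omega

/-- Normalized final test. -/
def answer : Expr := .not (.not (Prog.result base₁ base₂))

/-- The whole machine as a structured command. -/
def machine : Cmd :=
  .seq prelude <| .seq ((Prog.main base₁ base₂).comp 20) <|
    .seq (answer.comp 20) (.ins (.add 0 20 0))

/-- The largest variable in use is `17`, so registers from `20` on are free for temporaries. -/
theorem wf_main : (Prog.main base₁ base₂).Wf 20 := by
  simp [Prog.main, Prog.letters, Prog.reachBoth, Prog.reach, Prog.pairs, Prog.startPairs,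
    Prog.stepPairs, Prog.assign, Prog.fill, Prog.onLoop, Prog.Wf, Expr.Wf, Expr.addr, Expr.cell,
    Expr.startAt, Expr.stepAt, Expr.and, Expr.not, Expr.eq, Expr.mulVar, base₁, base₂]

theorem wf_answer : answer.Wf 20 := by
  simp [answer, Prog.result, Expr.Wf, Expr.addr, Expr.cell, Expr.acceptAt, Expr.and, Expr.not,
    Expr.mulVar, base₁, base₂]

theorem runs_machine {m n₁ n₂ K : ℕ} (A₁ : NFA (Fin m) (Fin n₁)) (A₂ : NFA (Fin m) (Fin n₂))
    (hK : side m n₁ n₂ ≤ K) :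
    ∃ reg mem t, Cmd.Runs machine (fun _ => 0) (fun i => (encodePair A₁ A₂).getD i 0) reg mem t ∧
      t ≤ ((Prog.main base₁ base₂).cost + answer.cost + 10).eval K ∧
      reg 0 = bit (∃ π, IsNonPTSepWitness A₁ A₂ π) := by
  obtain ⟨reg₁, hrun₁, hρ, hle⟩ := runs_prelude (m := m) (n₁ := n₁) (n₂ := n₂)
    (mem := fun i => (encodePair A₁ A₂).getD i 0) rfl rfl rfl
  obtain ⟨reg₂, t₂, hrun₂, ht₂, hr₂⟩ := Prog.runs_comp wf_main (d := 20) le_rfl (by omega)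
    (mem := fun i => (encodePair A₁ A₂).getD i 0) hρ.zero fun r _ => (hle r).trans hK
  obtain ⟨reg₃, t₃, hrun₃, ht₃, hv₃, hr₃⟩ := Expr.runs_comp wf_answer (d := 20) (reg := reg₂)
    (mem := (Prog.main base₁ base₂).eval reg₁ fun i => (encodePair A₁ A₂).getD i 0) (K := K)
    le_rfl (by omega) (by rw [hr₂ 0 (by omega), hρ.zero]) fun r hr => by
      rw [hr₂ r hr]
      exact (hle r).trans hK
  refine ⟨_, _, _, .seq hrun₁ (.seq hrun₂ (.seq hrun₃ (Cmd.runs_add ..))), ?_, ?_⟩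
  -- The `10` is made up of `9` steps of `prelude` and the final move to register `0`.
  · simp only [Polynomial.eval_add, Polynomial.eval_ofNat]
    omega
  · rw [Function.update_self, hv₃, hr₃ 0 (by omega), hr₂ 0 (by omega), hρ.zero, add_zero,
      Expr.eval_congr wf_answer hr₂]
    have h := Prog.eval_result (input₁ A₁ A₂) (input₂ A₁ A₂) hρ fun _ _ => rfl
    simp only [answer, Expr.eval_not, bit]
    split_ifs with hw
    · have := h.2 hw
      omega
    · have := mt h.1 hw
      omega

end Machine

end RAM

/-! ### The time bound in terms of the sizes of the automata -/

theorem NFA.card_le_size {α : Type*} {n : ℕ} (A : NFA α (Fin n)) : n ≤ A.size := by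
  simp [NFA.size]

theorem proposition2 :
    ∃ (P : RAM.Program) (T : MvPolynomial (Fin 3) ℕ),
      ∀ (m n₁ n₂ : ℕ) (A₁ : NFA (Fin m) (Fin n₁)) (A₂ : NFA (Fin m) (Fin n₂)),
        RAM.OutputsInTime P (encodePair A₁ A₂)
          (bit (∃ π : FactorizationPair (Fin m), IsNonPTSepWitness A₁ A₂ π))
          (MvPolynomial.eval ![A₁.size, A₂.size, m] T) := by
  -- The cost polynomial in one variable, evaluated at `m + A₁.size + A₂.size + 3`, which bounds
  -- `side m n₁ n₂`.
  refine ⟨RAM.machine.code 0, Polynomial.eval₂ MvPolynomial.C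
    (MvPolynomial.X 2 + MvPolynomial.X 0 + MvPolynomial.X 1 + MvPolynomial.C 3)
    ((RAM.Prog.main RAM.base₁ RAM.base₂).cost + RAM.answer.cost + 10), ?_⟩
  intro m n₁ n₂ A₁ A₂
  obtain ⟨reg, mem, t, hrun, ht, h0⟩ := RAM.runs_machine A₁ A₂ (K := m + A₁.size + A₂.size + 3)
    (by have := A₁.card_le_size; have := A₂.card_le_size; unfold RAM.side; omega)
  rw [← h0]
  refine hrun.outputsInTime (ht.trans_eq ?_)
  rw [Polynomial.hom_eval₂]
  simp only [map_add, MvPolynomial.eval_X, MvPolynomial.eval_C]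
  rw [show (MvPolynomial.eval ![A₁.size, A₂.size, m]).comp MvPolynomial.C = RingHom.id ℕ from
    Subsingleton.elim _ _]
  rfl
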